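/- Let $\Omega=(-\pi,\pi)$ and $0<\alpha<2$. For $\varphi\in C_c^\infty(\Omega)$ (extended by zero to $\mathbb R$) put $$(-\Delta)^{\alpha/2}\varphi(x)=C(1,\alpha)\lim_{\varepsilon\to0+}\int_{|x-y|>\varepsilon}\frac{\varphi(x)-\varphi(y)}{|x-y|^{1+\alpha}}\,dy,\qquad C(1,\alpha)=\frac{\alpha}{2^{1-\alpha}\pi^{1/2}}\,\frac{\Gamma(\frac{1+\alpha}{2})}{\Gamma(1-\frac{\alpha}{2})}.$$ Let $H_0^{\alpha/2}(\Omega)$ be the closure of $C_c^\infty(\Omega)$ in the norm $\|u\|^2=\int_{\mathbb R}|u|^2\,dx+\iint_{\mathbb R^2}\frac{|u(x)-u(y)|^2}{|x-y|^{1+\alpha}}\,dx\,dy$ of $H^{\alpha/2}(\mathbb R)$. Let $A_\alpha=-(-\Delta)^{\alpha/2}$ be the operator on $L^2(\Omega)$ whose domain consists of those $u\in H_0^{\alpha/2}(\Omega)$ for which the distribution $(-\Delta)^{\alpha/2}u$ on $\Omega$ is a function $w\in L^2(\Omega)$, i.e. $\int_\Omega u\,(-\Delta)^{\alpha/2}\varphi\,dx=\int_\Omega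 w\,\varphi\,dx$ for all $\varphi\in C_c^\infty(\Omega)$, with $A_\alpha u=-w$; let $e^{tA_\alpha}$, $t\ge0$, be the strongly continuous semigroup on $L^2(\Omega)$ generated by $A_\alpha$. **Theorem (local existence).** Let $f:H_0^{\alpha/2}(\Omega)\to H_0^{\alpha/2}(\Omega)$ be locally Lipschitz continuous, $g\in L^2(\Omega)$ and $u_0\in H_0^{\alpha/2}(\Omega)$. Then there is $T_0>0$ such that for every $T\in(0,T_0]$ the problem $$u_t+(-\Delta)^{\alpha/2}u+f(u)=g\ \text{ in }\Omega,\qquad u=0\ \text{ on }\mathbb R\setminus\Omega,\qquad u(0)=u_0,$$ has exactly one mild solution on $[0,T]$, that is, exactly one $u\in C^0([0,T],H_0^{\alpha/2}(\Omega))$ with $$u(t)=e^{tA_\alpha}u_0-\int_0^t e^{(t-\tau)A_\alpha}\bigl(f(u(\tau))-g\bigr)\,d\tau,\qquad 0\le t\le T.$$ -/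

import Mathlib

open MeasureTheory Filter Set
open scoped Topology ENNReal ContDiff

noncomputable section

namespace FracDiffusion

/-- The spatial domain `Ω = (-π, π)`. -/
abbrev Om : Set ℝ := Ioo (-Real.pi) Real.pi

/-- The real Hilbert space `L²(Ω)`. -/
abbrev L2Om : Type := Lp ℝ 2 (volume.restrict Om)

/-- The real Hilbert space `L²(ℝ × ℝ)`. -/
abbrev L2Plane : Type := Lp ℝ 2 (volume : Measure (ℝ × ℝ))

/-- `φ ∈ C_c^∞(Ω)`, as a function on the whole line that vanishes outside `Ω`. -/
def IsTestFunction (φ : ℝ → ℝ) : Prop :=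
  ContDiff ℝ ∞ φ ∧ HasCompactSupport φ ∧ tsupport φ ⊆ Om

/-- The normalising constant
`C(1, α) = α / (2 ^ (1 - α) π ^ (1/2)) * Γ((1 + α)/2) / Γ(1 - α/2)`. -/
def fracConst (α : ℝ) : ℝ :=
  α / ((2 : ℝ) ^ (1 - α) * Real.pi ^ ((1 : ℝ) / 2)) *
    (Real.Gamma ((1 + α) / 2) / Real.Gamma (1 - α / 2))

/-- The fractional Laplacian of a test function as a principal value integral,
`(-Δ)^{α/2} φ (x) = C(1, α) lim_{ε → 0+} ∫_{|x - y| > ε} (φ x - φ y) / |x - y| ^ (1 + α) dy`. -/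
def fracLap (α : ℝ) (φ : ℝ → ℝ) (x : ℝ) : ℝ :=
  fracConst α *
    limUnder (𝓝[>] (0 : ℝ)) fun ε : ℝ =>
      ∫ y in {y : ℝ | ε < |x - y|}, (φ x - φ y) / |x - y| ^ (1 + α)

/-- The Gagliardo difference quotient `(u x - u y) / |x - y| ^ ((1 + α)/2)`; its square integral
over the plane is the square of the Gagliardo seminorm of order `α/2`. -/
def diffQuot (α : ℝ) (u : ℝ → ℝ) (p : ℝ × ℝ) : ℝ :=
  (u p.1 - u p.2) / |p.1 - p.2| ^ ((1 + α) / 2)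

/-- The test functions `φ ∈ C_c^∞(Ω)`, each represented by the pair consisting of `φ` itself and
its difference quotient. The norm of the pair is the `H^{α/2}(ℝ)`-norm of `φ`,
`‖φ‖² = ∫ |φ|² + ∬ |φ x - φ y|² / |x - y| ^ (1 + α)`. -/
def testPairs (α : ℝ) : Submodule ℝ (WithLp 2 (L2Om × L2Plane)) where
  carrier := {U | ∃ φ : ℝ → ℝ, IsTestFunction φ ∧
    (U.fst : ℝ → ℝ) =ᵐ[volume.restrict Om] φ ∧ (U.snd : ℝ × ℝ → ℝ) =ᵐ[volume] diffQuot α φ}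
  zero_mem' := by
    refine ⟨fun _ => 0, ⟨contDiff_const, HasCompactSupport.zero, ?_⟩, ?_, ?_⟩
    · have h : tsupport (fun _ : ℝ => (0 : ℝ)) = ∅ := tsupport_eq_empty_iff.2 rfl
      rw [h]; exact empty_subset _
    · exact Lp.coeFn_zero _ _ _
    · refine (Lp.coeFn_zero _ _ _).trans (Eventually.of_forall fun p => ?_)
      simp [diffQuot]
  add_mem' := by
    rintro U V ⟨φ, ⟨h1, h2, h3⟩, h4, h5⟩ ⟨ψ, ⟨k1, k2, k3⟩, k4, k5⟩
    refine ⟨φ + ψ, ⟨h1.add k1, h2.add k2, (tsupport_add φ ψ).trans (union_subset h3 k3)⟩, ?_, ?_⟩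
    · exact (Lp.coeFn_add U.fst V.fst).trans (h4.add k4)
    · refine ((Lp.coeFn_add U.snd V.snd).trans (h5.add k5)).trans (Eventually.of_forall fun p => ?_)
      simp only [diffQuot, Pi.add_apply]
      ring
  smul_mem' := by
    rintro c U ⟨φ, ⟨h1, h2, h3⟩, h4, h5⟩
    refine ⟨c • φ, ⟨h1.const_smul c, h2.smul_left (f := fun _ => c),
      (tsupport_smul_subset_right (fun _ => c) φ).trans h3⟩, ?_, ?_⟩
    · exact (Lp.coeFn_smul c U.fst).trans (h4.const_smul c)
    · refine ((Lp.coeFn_smul c U.snd).trans (h5.const_smul c)).trans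
        (Eventually.of_forall fun p => ?_)
      simp only [diffQuot, Pi.smul_apply, smul_eq_mul]
      ring

/-- The space `H_0^{α/2}(Ω)`: the closure of `C_c^∞(Ω)` (functions extended by zero to the line)
in the norm of `H^{α/2}(ℝ)`. An element `U` carries the function itself, `toL2 U ∈ L²(Ω)`, and its
difference quotient in `L²(ℝ × ℝ)`. The Hilbert space structure is the induced one. -/
abbrev H0 (α : ℝ) : Type := (testPairs α).topologicalClosure

/-- The inclusion of `H_0^{α/2}(Ω)` in `L²(Ω)`. -/
def toL2 {α : ℝ} (U : H0 α) : L2Om := U.1.fst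

/-- The graph of the fractional Laplacian on `L²(Ω)` with the exterior condition `u = 0` off `Ω`:
`u` belongs to `H_0^{α/2}(Ω)` and `(-Δ)^{α/2} u = w` holds in the sense of distributions on `Ω`,
with `w ∈ L²(Ω)`. -/
def IsFracLap (α : ℝ) (u w : L2Om) : Prop :=
  (∃ U : H0 α, toL2 U = u) ∧
    ∀ φ : ℝ → ℝ, IsTestFunction φ →
      ∫ x in Om, u x * fracLap α φ x = ∫ x in Om, w x * φ x

/-- `S t`, `t ≥ 0`, is the strongly continuous semigroup `e^{t A}` on `L²(Ω)` whose infinitesimal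
generator is `A = -(-Δ)^{α/2}`, including equality of the domains. Values at `t < 0` play no
role. -/
structure IsFracSemigroup (α : ℝ) (S : ℝ → L2Om →L[ℝ] L2Om) : Prop where
  zero : S 0 = ContinuousLinearMap.id ℝ L2Om
  add : ∀ s t : ℝ, 0 ≤ s → 0 ≤ t → S (s + t) = (S s).comp (S t)
  cont : ∀ u : L2Om, ContinuousOn (fun t => S t u) (Ici 0)
  generator : ∀ u w : L2Om,
    Tendsto (fun t : ℝ => t⁻¹ • (S t u - u)) (𝓝[>] 0) (𝓝 w) ↔ IsFracLap α u (-w)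

/-- `u ∈ C([0, T], H_0^{α/2}(Ω))` is a mild solution on `[0, T]` of
`u_t + (-Δ)^{α/2} u + f(u) = g`, `u(0) = u₀`, that is
`u(t) = e^{tA} u₀ - ∫_0^t e^{(t-τ)A} (f(u(τ)) - g) dτ` for `0 ≤ t ≤ T`, with the (Bochner)
integral in `L²(Ω)`; for continuous `f` its integrand is continuous in `τ`. -/
def IsMildSolution (α : ℝ) (f : H0 α → H0 α) (g : L2Om) (u₀ : H0 α) (T : ℝ)
    (u : ℝ → H0 α) : Prop :=
  ContinuousOn u (Icc 0 T) ∧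
    ∃ S : ℝ → L2Om →L[ℝ] L2Om, IsFracSemigroup α S ∧
      ∀ t ∈ Icc 0 T,
        toL2 (u t) = S t (toL2 u₀) - ∫ τ in (0 : ℝ)..t, S (t - τ) (toL2 (f (u τ)) - g)

end FracDiffusion

end

/-! ### Strongly continuous semigroups and dissipative generators. -/

namespace ContractionSemigroup

open scoped RealInnerProductSpace

variable {X : Type*} [NormedAddCommGroup X] [InnerProductSpace ℝ X]

/-! Let `V` be the form space, `H = L²(Ω)` and `j : V → H` the inclusion, a contraction that is
injective with dense range. Symmetrising the singular integral (`integral_mul_symmLap`,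
`integral_mul_fracLap`) shows that pairing `u` with `(-Δ)^{α/2} φ` gives `c = C(1,α)/2` times the
inner product of difference quotients. The norm of `V` adds to this the `L²` inner product, so by
duality the generator relation `A u = w` is exactly `u = j j* (u - w/c)` (`isFracLap_neg_iff`). Thus
`A/c = 1 - R⁻¹` with `R = j j*`, and everything is expressed through the bounded operator `R`.

No spectral theorem is needed to build the semigroup. The bounded operators `∑_{k=1}^{n} (1-R)^k`
are nonnegative, commute, and converge to `R⁻¹ - 1` on the range of `R`, because `(1-R)^k → 0`
strongly (`tendsto_compl_pow`). Their exponentials are contractions and converge strongly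
(`exists_limit`); the limit has the right generator (`hasGenerator_iff`), and a dissipativity
argument makes it the only semigroup that does.

The same construction with `j* j` gives a contraction semigroup `P` on `V`, and `j` intertwines the
two (`resolventSemigroup_intertwine`). Since `f` maps `V` to itself, the nonlinear term is then
handled inside `V` with no smoothing estimate. The forcing `g` lies only in `H`, but `∫_0^t S(τ) g
dτ` lies in the range of `R` (`integral_resolventSemigroup_eq`), so it is the image of a continuous
`V`-valued function. As `j` is injective, the mild equation in `H` is equivalent to a Duhamel
equation in `V`, solved by contraction mapping on a short interval; uniqueness comes from Gronwall's
inequality. -/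

/-- A dissipative evolution starting at zero vanishes. -/
theorem eq_zero_of_dissipative {y w : ℝ → X} (hy : ContinuousOn y (Ici 0))
    (hd : ∀ s, 0 ≤ s → HasDerivWithinAt y (w s) (Ici s) s)
    (hdis : ∀ s, 0 ≤ s → ⟪w s, y s⟫ ≤ 0) (h0 : y 0 = 0) {t : ℝ} (ht : 0 ≤ t) : y t = 0 := by
  have key : ‖y t‖ ^ 2 ≤ 0 := by
    refine image_le_of_deriv_right_le_deriv_boundary (a := 0) (b := t)
      (f := fun s => ‖y s‖ ^ 2) (f' := fun s => 2 * ⟪y s, w s⟫) (B := fun _ => 0)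
      (B' := fun _ => 0) ?_ ?_ ?_ continuousOn_const ?_ ?_ ⟨ht, le_rfl⟩
    · exact ((hy.mono Icc_subset_Ici_self).norm).pow 2
    · intro x hx
      exact (hd x hx.1).norm_sq
    · simp [h0]
    · intro x _
      exact hasDerivWithinAt_const _ _ _
    · intro x hx
      have := hdis x hx.1
      rw [real_inner_comm] at this
      linarith
  have : ‖y t‖ = 0 := by nlinarith [norm_nonneg (y t)]
  exact norm_eq_zero.1 this

/-- The difference quotients of `S` at `u` converge to `w`. -/
def HasGenerator (S : ℝ → X →L[ℝ] X) (u w : X) : Prop :=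
  Tendsto (fun t : ℝ => t⁻¹ • (S t u - u)) (𝓝[>] 0) (𝓝 w)

/-- Strongly continuous one-parameter semigroups; values at negative times are unconstrained. -/
structure IsC0Semigroup (S : ℝ → X →L[ℝ] X) : Prop where
  zero : S 0 = ContinuousLinearMap.id ℝ X
  add : ∀ s t : ℝ, 0 ≤ s → 0 ≤ t → S (s + t) = (S s).comp (S t)
  cont : ∀ u : X, ContinuousOn (fun t => S t u) (Ici 0)

theorem HasGenerator.sub {S : ℝ → X →L[ℝ] X} {u w u' w' : X} (h : HasGenerator S u w)
    (h' : HasGenerator S u' w') : HasGenerator S (u - u') (w - w') := by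
  refine (Tendsto.sub h h').congr fun t => ?_
  rw [← smul_sub, map_sub]
  congr 1
  abel

theorem IsC0Semigroup.hasGenerator_apply {S : ℝ → X →L[ℝ] X} (hS : IsC0Semigroup S) {u w : X}
    (h : HasGenerator S u w) {s : ℝ} (hs : 0 ≤ s) : HasGenerator S (S s u) (S s w) := by
  have h1 : Tendsto (fun t : ℝ => S s (t⁻¹ • (S t u - u))) (𝓝[>] 0) (𝓝 (S s w)) :=
    ((S s).continuous.tendsto w).comp h
  refine h1.congr' ?_
  filter_upwards [self_mem_nhdsWithin] with t ht
  have ht' : 0 ≤ t := le_of_lt ht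
  have : S t (S s u) = S s (S t u) := by
    rw [← ContinuousLinearMap.comp_apply, ← hS.add t s ht' hs, add_comm, hS.add s t hs ht']
    rfl
  rw [this, map_smul, map_sub]

theorem IsC0Semigroup.hasDerivWithinAt {S : ℝ → X →L[ℝ] X} (hS : IsC0Semigroup S) {u w : X}
    (h : HasGenerator S u w) {s : ℝ} (hs : 0 ≤ s) :
    HasDerivWithinAt (fun t => S t u) (S s w) (Ici s) s := by
  rw [hasDerivWithinAt_iff_tendsto_slope, Ici_sdiff_left]
  have h1 := hS.hasGenerator_apply h hs
  have h2 : Tendsto (fun t : ℝ => t - s) (𝓝[>] s) (𝓝[>] 0) := by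
    refine tendsto_nhdsWithin_iff.2 ⟨?_, ?_⟩
    · have : Tendsto (fun t : ℝ => t - s) (𝓝 s) (𝓝 (s - s)) :=
        (continuous_id.sub continuous_const).tendsto s
      rw [sub_self] at this
      exact this.mono_left nhdsWithin_le_nhds
    · filter_upwards [self_mem_nhdsWithin] with t (ht : s < t)
      exact sub_pos.2 ht
  refine (Tendsto.comp h1 h2).congr' ?_
  filter_upwards [self_mem_nhdsWithin] with t (ht : s < t)
  have ht' : 0 ≤ t - s := (sub_pos.2 ht).le
  have e : S t u = S (t - s) (S s u) := by
    rw [← ContinuousLinearMap.comp_apply, ← hS.add _ _ ht' hs, sub_add_cancel]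
  simp [slope, e]

/-- A semigroup with a densely defined dissipative generator is determined by its generator. -/
theorem IsC0Semigroup.unique {S S' : ℝ → X →L[ℝ] X} (hS : IsC0Semigroup S)
    (hS' : IsC0Semigroup S') (hG : ∀ u w, HasGenerator S u w → HasGenerator S' u w)
    (hdis : ∀ u w, HasGenerator S' u w → ⟪w, u⟫ ≤ 0)
    (hdense : Dense {u | ∃ w, HasGenerator S u w}) {t : ℝ} (ht : 0 ≤ t) : S t = S' t := by
  refine ContinuousLinearMap.ext fun x => congrFun (Continuous.ext_on hdense (S t).continuous (S' t).continuous ?_) x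
  rintro u ⟨w, hw⟩
  have h' := hG u w hw
  -- Both orbits of `u` stay in the domain, and the generator of `S` is contained in that of `S'`.
  -- Their difference therefore evolves by the dissipative generator of `S'` and starts at zero.
  refine sub_eq_zero.1 (eq_zero_of_dissipative (y := fun s => S s u - S' s u)
    (w := fun s => S s w - S' s w) ((hS.cont u).sub (hS'.cont u)) ?_ ?_ ?_ ht)
  · intro s hs
    exact (hS.hasDerivWithinAt hw hs).sub (hS'.hasDerivWithinAt h' hs)
  · intro s hs
    exact hdis _ _ ((hG _ _ (hS.hasGenerator_apply hw hs)).sub (hS'.hasGenerator_apply h' hs))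
  · simp [hS.zero, hS'.zero]

/-! ### Strong limits of contractions. -/

section Limits

variable {Y : Type*} [NormedAddCommGroup Y] [NormedSpace ℝ Y]

theorem tendsto_apply_of_contraction {T : ℕ → Y →L[ℝ] Y} (hT : ∀ n x, ‖T n x‖ ≤ ‖x‖)
    {L : Y} {x : ℕ → Y} {x₀ : Y} (hL : Tendsto (fun n => T n x₀) atTop (𝓝 L))
    (hx : Tendsto x atTop (𝓝 x₀)) : Tendsto (fun n => T n (x n)) atTop (𝓝 L) := by
  have h1 : Tendsto (fun n => T n (x n - x₀)) atTop (𝓝 0) := by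
    refine squeeze_zero_norm (fun n => hT n _) ?_
    have := (hx.sub_const x₀).norm
    simpa using this
  have := h1.add hL
  refine (this.congr fun n => ?_).trans (by simp)
  rw [map_sub, sub_add_cancel]

theorem exists_limit_of_contraction [CompleteSpace Y] {T : ℕ → Y →L[ℝ] Y}
    (hT : ∀ n x, ‖T n x‖ ≤ ‖x‖) {D : Set Y} (hD : Dense D)
    (hc : ∀ x ∈ D, CauchySeq fun n => T n x) :
    ∃ L : Y →L[ℝ] Y, ∀ x, Tendsto (fun n => T n x) atTop (𝓝 (L x)) := by
  have hall : ∀ x, CauchySeq fun n => T n x := by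
    intro x
    rw [Metric.cauchySeq_iff]
    intro ε hε
    obtain ⟨y, hy, hxy⟩ := hD.exists_dist_lt x (show 0 < ε / 3 by positivity)
    obtain ⟨N, hN⟩ := Metric.cauchySeq_iff.1 (hc y hy) (ε / 3) (by positivity)
    refine ⟨N, fun m hm n hn => ?_⟩
    have key : ∀ k, dist (T k x) (T k y) ≤ dist x y := fun k => by
      rw [dist_eq_norm, dist_eq_norm, ← map_sub]; exact hT k _
    have h1 := key m
    have h2 := key n
    have h3 := hN m hm n hn
    have h4 := dist_triangle4 (T m x) (T m y) (T n y) (T n x)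
    rw [dist_comm (T n y)] at h4
    linarith
  choose L hL using fun x => cauchySeq_tendsto_of_complete (hall x)
  have hL' : Tendsto (fun n x => T n x) atTop (𝓝 L) := tendsto_pi_nhds.2 hL
  exact ⟨continuousLinearMapOfTendsto _ hL', hL⟩

end Limits

/-! ### Exponentials of bounded operators with nonnegative form. -/

section Exp

/-- The semigroup generated by the bounded operator `-B`. -/
noncomputable def expNeg (B : X →L[ℝ] X) (t : ℝ) : X →L[ℝ] X := NormedSpace.exp (t • (-B))

theorem expNeg_zero (B : X →L[ℝ] X) : expNeg B 0 = 1 := by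
  simp [expNeg, NormedSpace.exp_zero]

theorem expNeg_add [CompleteSpace X] (B : X →L[ℝ] X) (s t : ℝ) : expNeg B (s + t) = expNeg B s * expNeg B t := by
  unfold expNeg
  rw [add_smul]
  let : NormedAlgebra ℚ (X →L[ℝ] X) := NormedAlgebra.restrictScalars ℚ ℝ _
  exact NormedSpace.exp_add_of_commute
    (((Commute.refl (-B)).smul_left s).smul_right t)

theorem commute_expNeg {B C : X →L[ℝ] X} (h : Commute C B) (t : ℝ) : Commute C (expNeg B t) :=
  ((h.neg_right).smul_right t).exp_right

theorem hasDerivAt_expNeg [CompleteSpace X] (B : X →L[ℝ] X) (x : X) (t : ℝ) :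
    HasDerivAt (fun s => expNeg B s x) (-(B (expNeg B t x))) t := by
  have := (hasDerivAt_exp_smul_const' (𝕂 := ℝ) (-B) t).clm_apply (hasDerivAt_const t x)
  simpa [expNeg] using this

theorem continuous_expNeg [CompleteSpace X] (B : X →L[ℝ] X) (x : X) : Continuous fun s => expNeg B s x :=
  continuous_iff_continuousAt.2 fun t => (hasDerivAt_expNeg B x t).continuousAt

theorem norm_expNeg_le [CompleteSpace X] {B : X →L[ℝ] X} (hB : ∀ x, 0 ≤ ⟪B x, x⟫) {t : ℝ} (ht : 0 ≤ t) (x : X) :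
    ‖expNeg B t x‖ ≤ ‖x‖ := by
  have key : ‖expNeg B t x‖ ^ 2 ≤ ‖x‖ ^ 2 := by
    refine image_le_of_deriv_right_le_deriv_boundary (a := 0) (b := t)
      (f := fun s => ‖expNeg B s x‖ ^ 2)
      (f' := fun s => 2 * ⟪expNeg B s x, -(B (expNeg B s x))⟫) (B := fun _ => ‖x‖ ^ 2)
      (B' := fun _ => 0) ?_ ?_ ?_ continuousOn_const ?_ ?_ ⟨ht, le_rfl⟩
    · exact ((continuous_expNeg B x).norm.pow 2).continuousOn
    · intro s _
      exact (hasDerivAt_expNeg B x s).norm_sq.hasDerivWithinAt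
    · simp [expNeg_zero]
    · intro x _
      exact hasDerivWithinAt_const _ _ _
    · intro s _
      have := hB (expNeg B s x)
      rw [real_inner_comm] at this
      rw [inner_neg_right]
      linarith
  exact le_of_sq_le_sq key (norm_nonneg _)

theorem norm_expNeg_sub_expNeg_time_le [CompleteSpace X] {B : X →L[ℝ] X} (hB : ∀ x, 0 ≤ ⟪B x, x⟫) {s t : ℝ}
    (hs : 0 ≤ s) (hst : s ≤ t) (x : X) :
    ‖expNeg B t x - expNeg B s x‖ ≤ ‖B x‖ * (t - s) := by
  refine norm_image_sub_le_of_norm_deriv_le_segment' (f' := fun r => -(B (expNeg B r x)))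
    (fun r _ => (hasDerivAt_expNeg B x r).hasDerivWithinAt) (fun r hr => ?_) t ⟨hst, le_rfl⟩
  rw [norm_neg, ← mul_apply_eq_comp, (commute_expNeg (Commute.refl B) r).eq]
  exact norm_expNeg_le hB (hs.trans hr.1) _

/-- The path `r ↦ e^{-(t-r)C} e^{-rB} x` joins the two vectors, and its derivative is a product of
contractions applied to `C x - B x`. This turns convergence of generators at a vector into
convergence of exponentials there. -/
theorem norm_expNeg_sub_le [CompleteSpace X] {B C : X →L[ℝ] X} (hB : ∀ x, 0 ≤ ⟪B x, x⟫) (hC : ∀ x, 0 ≤ ⟪C x, x⟫)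
    (hBC : Commute B C) {t : ℝ} (ht : 0 ≤ t) (x : X) :
    ‖expNeg B t x - expNeg C t x‖ ≤ ‖B x - C x‖ * t := by
  have hd : ∀ r ∈ Icc 0 t, HasDerivWithinAt (fun r => expNeg C (t - r) (expNeg B r x))
      (expNeg C (t - r) (expNeg B r (C x - B x))) (Icc 0 t) r := by
    intro r _
    have h1 : HasDerivAt (fun r : ℝ => expNeg C (t - r))
        ((-1 : ℝ) • (-C * expNeg C (t - r))) r := by
      have h0 : HasDerivAt (fun r : ℝ => t - r) (-1) r := by
        simpa using (hasDerivAt_id r).const_sub t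
      exact (hasDerivAt_exp_smul_const' (𝕂 := ℝ) (-C) (t - r)).scomp r h0
    have h2 := h1.clm_apply (hasDerivAt_expNeg B x r)
    refine (h2.congr_deriv ?_).hasDerivWithinAt
    have e1 : C (expNeg C (t - r) (expNeg B r x)) = expNeg C (t - r) (expNeg B r (C x)) := by
      have a := DFunLike.congr_fun (commute_expNeg (Commute.refl C) (t - r)).eq (expNeg B r x)
      have b := DFunLike.congr_fun (commute_expNeg hBC.symm r).eq x
      simp only [mul_apply_eq_comp] at a b
      rw [a, b]
    have e2 : B (expNeg B r x) = expNeg B r (B x) :=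
      DFunLike.congr_fun (commute_expNeg (Commute.refl B) r).eq x
    simp only [map_sub, map_neg, neg_smul, one_smul, neg_mul, neg_neg,
      mul_apply_eq_comp, e1, e2]
    abel
  have := norm_image_sub_le_of_norm_deriv_le_segment' (C := ‖B x - C x‖) hd (fun r hr => ?_) t
    ⟨ht, le_rfl⟩
  · simpa [expNeg_zero] using this
  · refine (norm_expNeg_le hC (sub_nonneg.2 hr.2.le) _).trans
      ((norm_expNeg_le hB hr.1 _).trans ?_)
    rw [norm_sub_rev]

end Exp

end ContractionSemigroup

/-! ### The semigroup generated by `1 - R⁻¹`. -/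

namespace ContractionSemigroup

open scoped RealInnerProductSpace

variable {X : Type*} [NormedAddCommGroup X] [InnerProductSpace ℝ X]

/-- `R` has the form `(1 + A)⁻¹` with `A` nonnegative self-adjoint, possibly unbounded. -/
structure IsPosResolvent (R : X →L[ℝ] X) : Prop where
  symm : ∀ x y, ⟪R x, y⟫ = ⟪x, R y⟫
  nonneg : ∀ x, 0 ≤ ⟪R x, x⟫
  le : ∀ x, ⟪R x, x⟫ ≤ ⟪x, x⟫
  inj : ∀ x, R x = 0 → x = 0

theorem inner_pow_symm {Q : X →L[ℝ] X} (hQ : ∀ x y, ⟪Q x, y⟫ = ⟪x, Q y⟫) (k : ℕ) (x y : X) :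
    ⟪(Q ^ k) x, y⟫ = ⟪x, (Q ^ k) y⟫ := by
  induction k generalizing x y with
  | zero => simp
  | succ k ih => rw [pow_succ, mul_apply_eq_comp, ih, hQ, ← mul_apply_eq_comp,
      ← pow_succ', pow_succ]

/-- Half of the factors move to the other side by symmetry, leaving a square for even powers and the
form of `Q` for odd ones. -/
theorem inner_pow_nonneg {Q : X →L[ℝ] X} (hQ : ∀ x y, ⟪Q x, y⟫ = ⟪x, Q y⟫)
    (hpos : ∀ x, 0 ≤ ⟪Q x, x⟫) (k : ℕ) (x : X) : 0 ≤ ⟪(Q ^ k) x, x⟫ := by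
  rcases Nat.even_or_odd' k with ⟨j, rfl | rfl⟩
  · rw [two_mul, pow_add, mul_apply_eq_comp, inner_pow_symm hQ]
    exact real_inner_self_nonneg
  · rw [show 2 * j + 1 = j + (1 + j) by ring, pow_add, mul_apply_eq_comp, inner_pow_symm hQ,
      pow_add, pow_one, mul_apply_eq_comp]
    exact hpos _

namespace IsPosResolvent

variable {R : X →L[ℝ] X} (hR : IsPosResolvent R)
include hR

theorem dense_range [CompleteSpace X] : Dense (range R) := by
  have : (LinearMap.range R.toLinearMap).topologicalClosure = ⊤ := by
    rw [Submodule.topologicalClosure_eq_top_iff, Submodule.eq_bot_iff]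
    intro x hx
    refine hR.inj x (inner_self_eq_zero (𝕜 := ℝ) |>.1 ?_)
    rw [← hR.symm]
    exact Submodule.inner_right_of_mem_orthogonal (LinearMap.mem_range_self R.toLinearMap (R x)) hx
  have h2 := Submodule.dense_iff_topologicalClosure_eq_top.2 this
  exact h2

theorem compl_symm (x y : X) : ⟪(1 - R) x, y⟫ = ⟪x, (1 - R) y⟫ := by
  simp [inner_sub_left, inner_sub_right, hR.symm]

theorem compl_nonneg (x : X) : 0 ≤ ⟪(1 - R) x, x⟫ := by
  have := hR.le x
  simpa [inner_sub_left] using this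

/-- Splitting the second argument as `z = R z + (1 - R) z` leaves the form of `1 - R` at `R z` and
the form of `R` at `(1 - R) z`. -/
theorem compl_comp_nonneg (z : X) : 0 ≤ ⟪(1 - R) (R z), z⟫ := by
  have e : ⟪(1 - R) (R z), z⟫ = ⟪(1 - R) (R z), R z⟫ + ⟪R ((1 - R) z), (1 - R) z⟫ := by
    simp only [_root_.sub_apply, one_apply_eq_self, map_sub, inner_sub_left,
      inner_sub_right, hR.symm]
    ring
  rw [e]
  exact add_nonneg (hR.compl_nonneg _) (hR.nonneg _)

theorem compl_pow_antitone (x : X) : Antitone fun k : ℕ => ⟪((1 - R) ^ k) x, x⟫ := by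
  refine antitone_nat_of_succ_le fun k => ?_
  have key : 0 ≤ ⟪((1 - R) ^ k) (R x), x⟫ := by
    have hc : ∀ j : ℕ, ((1 - R) ^ j) (R x) = R (((1 - R) ^ j) x) := fun j =>
      (DFunLike.congr_fun (((Commute.one_right R).sub_right (Commute.refl R)).pow_right j).eq x).symm
    rcases Nat.even_or_odd' k with ⟨j, rfl | rfl⟩
    · rw [two_mul, pow_add, mul_apply_eq_comp, inner_pow_symm hR.compl_symm, hc]
      exact hR.nonneg _
    · rw [show 2 * j + 1 = j + (1 + j) by ring, pow_add, mul_apply_eq_comp,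
        inner_pow_symm hR.compl_symm, pow_add, pow_one, mul_apply_eq_comp, hc]
      exact hR.compl_comp_nonneg _
  have e : ((1 - R) ^ (k + 1)) x = ((1 - R) ^ k) x - ((1 - R) ^ k) (R x) := by
    rw [pow_succ, mul_apply_eq_comp, ← map_sub]; rfl
  rw [e, inner_sub_left]
  linarith

theorem norm_compl_pow_sq (k : ℕ) (x : X) :
    ‖((1 - R) ^ k) x‖ ^ 2 = ⟪((1 - R) ^ (2 * k)) x, x⟫ := by
  rw [two_mul, pow_add, mul_apply_eq_comp, inner_pow_symm hR.compl_symm,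
    real_inner_self_eq_norm_sq]

theorem norm_compl_pow_le (k : ℕ) (x : X) : ‖((1 - R) ^ k) x‖ ≤ ‖x‖ := by
  refine le_of_sq_le_sq ?_ (norm_nonneg _)
  rw [hR.norm_compl_pow_sq]
  refine (hR.compl_pow_antitone x (Nat.zero_le _)).trans ?_
  simp

theorem tendsto_compl_pow [CompleteSpace X] (x : X) :
    Tendsto (fun k : ℕ => ((1 - R) ^ k) x) atTop (𝓝 0) := by
  have hlim : ∀ v, Tendsto (fun k : ℕ => ((1 - R) ^ k) (R v)) atTop (𝓝 0) := by
    intro v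
    have hb : BddBelow (range fun k : ℕ => ⟪((1 - R) ^ k) v, v⟫) := by
      refine ⟨0, ?_⟩
      rintro _ ⟨k, rfl⟩
      exact inner_pow_nonneg hR.compl_symm hR.compl_nonneg k v
    have hm := tendsto_atTop_ciInf (hR.compl_pow_antitone v) hb
    set m := ⨅ k : ℕ, ⟪((1 - R) ^ k) v, v⟫
    have h0 : Tendsto (fun k : ℕ => 2 * k) atTop atTop :=
      tendsto_id.const_mul_atTop' (by norm_num)
    have a0 := hm.comp h0
    have a1 := hm.comp ((tendsto_add_atTop_nat 1).comp h0)
    have a2 := hm.comp ((tendsto_add_atTop_nat 2).comp h0)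
    -- With `a k = ⟪(1-R)^k v, v⟫`, which is decreasing and bounded below, the squared norm is `a
    -- (2k) - 2 a (2k+1) + a (2k+2)`. A second difference of a convergent sequence tends to zero.
    have h1 : Tendsto (fun k : ℕ => ‖((1 - R) ^ k) (R v)‖ ^ 2) atTop (𝓝 0) := by
      have := (a0.sub (a1.const_mul 2)).add a2
      rw [show m - 2 * m + m = 0 by ring] at this
      refine this.congr fun k => ?_
      have e : ((1 - R) ^ k) (R v) = ((1 - R) ^ k) v - ((1 - R) ^ (k + 1)) v := by
        rw [pow_succ, mul_apply_eq_comp, ← map_sub]; simp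
      have e1 : ⟪((1 - R) ^ k) v, ((1 - R) ^ (k + 1)) v⟫ = ⟪((1 - R) ^ (2 * k + 1)) v, v⟫ := by
        rw [← inner_pow_symm hR.compl_symm, ← mul_apply_eq_comp, ← pow_add]
        congr 3; ring
      have e2 := hR.norm_compl_pow_sq (k + 1) v
      rw [e, norm_sub_sq_real, hR.norm_compl_pow_sq, e1, e2]
      simp only [Function.comp]
      rw [show 2 * (k + 1) = 2 * k + 2 by ring]
    have h2 := h1.sqrt
    simp only [Real.sqrt_sq (norm_nonneg _), Real.sqrt_zero] at h2
    exact tendsto_zero_iff_norm_tendsto_zero.2 h2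
  -- The powers are contractions, so convergence extends from the dense range of `R` to the whole
  -- space.
  obtain ⟨L, hL⟩ := exists_limit_of_contraction (T := fun k : ℕ => (1 - R) ^ k)
    hR.norm_compl_pow_le hR.dense_range (by
      rintro _ ⟨v, rfl⟩
      exact (hlim v).cauchySeq)
  have hL0 : ∀ y, L y = 0 := by
    have : (L : X → X) = fun _ => 0 := by
      refine Continuous.ext_on hR.dense_range L.continuous continuous_const ?_
      rintro _ ⟨v, rfl⟩
      exact tendsto_nhds_unique (hL _) (hlim v)
    exact fun y => congrFun this y
  simpa [hL0] using hL x

omit hR in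
/-- Bounded approximations of `A = R⁻¹ - 1`: partial sums of its Neumann series. -/
noncomputable def _root_.ContractionSemigroup.neumann (R : X →L[ℝ] X) (n : ℕ) : X →L[ℝ] X :=
  ∑ k ∈ Finset.range n, (1 - R) ^ (k + 1)

theorem neumann_nonneg (n : ℕ) (x : X) : 0 ≤ ⟪neumann R n x, x⟫ := by
  simp only [neumann, _root_.sum_apply, sum_inner]
  exact Finset.sum_nonneg fun k _ => inner_pow_nonneg hR.compl_symm hR.compl_nonneg _ x

omit hR in
theorem _root_.ContractionSemigroup.commute_neumann_of_commute {C : X →L[ℝ] X} (h : Commute C R)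
    (n : ℕ) : Commute C (neumann R n) :=
  Commute.sum_right _ _ _ fun k _ => (((Commute.one_right C).sub_right h).pow_right (k + 1))

omit hR in
theorem _root_.ContractionSemigroup.commute_neumann (m n : ℕ) :
    Commute (neumann R m) (neumann R n) :=
  commute_neumann_of_commute (commute_neumann_of_commute (Commute.refl R) m).symm n

omit hR in
-- The geometric sum telescopes after multiplication by `R = 1 - (1 - R)`. It makes the
-- approximations bounded on the range of `R` uniformly in `n`.
theorem _root_.ContractionSemigroup.neumann_apply_apply (n : ℕ) (h : X) :
    neumann R n (R h) = (1 - R) h - ((1 - R) ^ (n + 1)) h := by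
  induction n with
  | zero => simp [neumann]
  | succ n ih =>
    have e : ((1 - R) ^ (n + 1)) (R h) = ((1 - R) ^ (n + 1)) h - ((1 - R) ^ (n + 2)) h := by
      rw [pow_succ _ (n + 1), mul_apply_eq_comp, ← map_sub]; simp
    rw [neumann, Finset.sum_range_succ, _root_.add_apply, ← neumann, ih, e]
    abel

theorem tendsto_neumann [CompleteSpace X] (h : X) :
    Tendsto (fun n => neumann R n (R h)) atTop (𝓝 (h - R h)) := by
  have := ((hR.tendsto_compl_pow h).comp (tendsto_add_atTop_nat 1)).const_sub ((1 - R) h)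
  rw [sub_zero] at this
  exact this.congr fun n => (neumann_apply_apply n h).symm

theorem norm_neumann_le (n : ℕ) (h : X) : ‖neumann R n (R h)‖ ≤ 2 * ‖h‖ := by
  rw [neumann_apply_apply]
  have h1 := hR.norm_compl_pow_le 1 h
  have h2 := hR.norm_compl_pow_le (n + 1) h
  rw [pow_one] at h1
  linarith [norm_sub_le ((1 - R) h) (((1 - R) ^ (n + 1)) h)]

theorem exists_limit [CompleteSpace X] {t : ℝ} (ht : 0 ≤ t) :
    ∃ L : X →L[ℝ] X, ∀ x, Tendsto (fun n => expNeg (neumann R n) t x) atTop (𝓝 (L x)) := by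
  refine exists_limit_of_contraction (fun n x => norm_expNeg_le (hR.neumann_nonneg n) ht x)
    hR.dense_range ?_
  rintro _ ⟨h, rfl⟩
  have hc := (hR.tendsto_neumann h).cauchySeq
  rw [Metric.cauchySeq_iff] at hc ⊢
  intro ε hε
  -- Dividing by `t + 1` rather than `t` covers `t = 0`.
  obtain ⟨N, hN⟩ := hc (ε / (t + 1)) (by positivity)
  refine ⟨N, fun m hm n hn => ?_⟩
  have h1 := hN m hm n hn
  have h2 := norm_expNeg_sub_le (hR.neumann_nonneg m) (hR.neumann_nonneg n) (commute_neumann m n)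
    ht (R h)
  rw [dist_eq_norm] at h1 ⊢
  rw [lt_div_iff₀ (by positivity)] at h1
  have := norm_nonneg (neumann R m (R h) - neumann R n (R h))
  nlinarith

omit hR in
open Classical in
/-- The strong limit of the exponentials of the bounded approximations, if it exists. -/
noncomputable def _root_.ContractionSemigroup.expLimit (R : X →L[ℝ] X) (t : ℝ) : X →L[ℝ] X :=
  if h : ∃ L : X →L[ℝ] X, ∀ x, Tendsto (fun n => expNeg (neumann R n) t x) atTop (𝓝 (L x))
  then h.choose else 0

omit hR in
/-- The contraction semigroup with generator `1 - R⁻¹`, extended evenly to negative times. -/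
noncomputable def _root_.ContractionSemigroup.resolventSemigroup (R : X →L[ℝ] X) (t : ℝ) :
    X →L[ℝ] X :=
  expLimit R |t|

variable [CompleteSpace X]

theorem tendsto_resolventSemigroup {t : ℝ} (ht : 0 ≤ t) (x : X) :
    Tendsto (fun n => expNeg (neumann R n) t x) atTop (𝓝 (resolventSemigroup R t x)) := by
  rw [resolventSemigroup, abs_of_nonneg ht, expLimit, dif_pos (hR.exists_limit ht)]
  exact (hR.exists_limit ht).choose_spec x

omit hR [CompleteSpace X] in
theorem _root_.ContractionSemigroup.resolventSemigroup_abs (t : ℝ) :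
    resolventSemigroup R |t| = resolventSemigroup R t := by
  simp [resolventSemigroup]

theorem norm_resolventSemigroup_le (t : ℝ) (x : X) : ‖resolventSemigroup R t x‖ ≤ ‖x‖ := by
  rw [← resolventSemigroup_abs]
  exact le_of_tendsto (hR.tendsto_resolventSemigroup (abs_nonneg t) x).norm
    (Eventually.of_forall fun n => norm_expNeg_le (hR.neumann_nonneg n) (abs_nonneg t) x)

theorem commute_resolventSemigroup (t : ℝ) : Commute R (resolventSemigroup R t) := by
  rw [← resolventSemigroup_abs]
  refine ContinuousLinearMap.ext fun x => ?_
  have h1 := (R.continuous.tendsto _).comp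
    (hR.tendsto_resolventSemigroup (abs_nonneg t) x)
  refine tendsto_nhds_unique h1
    ((hR.tendsto_resolventSemigroup (abs_nonneg t) (R x)).congr fun n => ?_)
  exact (DFunLike.congr_fun
    (commute_expNeg (commute_neumann_of_commute (Commute.refl R) n) |t|).eq x).symm

theorem lipschitz_resolventSemigroup {s t : ℝ} (hs : 0 ≤ s) (hst : s ≤ t) (h : X) :
    ‖resolventSemigroup R t (R h) - resolventSemigroup R s (R h)‖ ≤ 2 * ‖h‖ * (t - s) := by
  refine le_of_tendsto ((hR.tendsto_resolventSemigroup (hs.trans hst) (R h)).sub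
    (hR.tendsto_resolventSemigroup hs (R h))).norm (Eventually.of_forall fun n => ?_)
  refine (norm_expNeg_sub_expNeg_time_le (hR.neumann_nonneg n) hs hst (R h)).trans ?_
  exact mul_le_mul_of_nonneg_right (hR.norm_neumann_le n h) (sub_nonneg.2 hst)

theorem continuous_resolventSemigroup (x : X) : Continuous fun t => resolventSemigroup R t x := by
  have key : ∀ h, Continuous fun t => resolventSemigroup R t (R h) := by
    intro h
    have : LipschitzWith (2 * ‖h‖₊) fun t => resolventSemigroup R t (R h) := by
      refine LipschitzWith.of_dist_le_mul fun a b => ?_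
      rw [← resolventSemigroup_abs, ← resolventSemigroup_abs b]
      have hab : |(|a| - |b|)| ≤ dist a b := abs_abs_sub_abs_le a b
      refine le_trans ?_ (mul_le_mul_of_nonneg_left hab (NNReal.coe_nonneg _))
      rw [dist_eq_norm]
      rcases le_total |a| |b| with hle | hle
      · rw [norm_sub_rev, abs_sub_comm, abs_of_nonneg (sub_nonneg.2 hle)]
        simpa using hR.lipschitz_resolventSemigroup (abs_nonneg a) hle h
      · rw [abs_of_nonneg (sub_nonneg.2 hle)]
        simpa using hR.lipschitz_resolventSemigroup (abs_nonneg b) hle h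
    exact this.continuous
  refine continuous_of_uniform_approx_of_continuous (f := fun t => resolventSemigroup R t x) ?_
  intro u hu
  obtain ⟨ε, hε, hεu⟩ := Metric.mem_uniformity_dist.1 hu
  obtain ⟨_, ⟨h, rfl⟩, hxy⟩ := hR.dense_range.exists_dist_lt x hε
  refine ⟨_, key h, fun t => hεu ?_⟩
  rw [dist_eq_norm, ← map_sub]
  rw [dist_eq_norm] at hxy
  exact (hR.norm_resolventSemigroup_le t _).trans_lt hxy

theorem isC0Semigroup : IsC0Semigroup (resolventSemigroup R) where
  zero := by
    refine ContinuousLinearMap.ext fun x => ?_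
    refine tendsto_nhds_unique (hR.tendsto_resolventSemigroup le_rfl x) ?_
    simp [expNeg_zero]
  add s t hs ht := by
    refine ContinuousLinearMap.ext fun x => ?_
    refine tendsto_nhds_unique (hR.tendsto_resolventSemigroup (add_nonneg hs ht) x) ?_
    refine (tendsto_apply_of_contraction
      (fun n x => norm_expNeg_le (hR.neumann_nonneg n) hs x)
      (hR.tendsto_resolventSemigroup hs _) (hR.tendsto_resolventSemigroup ht x)).congr fun n => ?_
    rw [expNeg_add, mul_apply_eq_comp]
  cont u := (hR.continuous_resolventSemigroup u).continuousOn

/-- For the bounded approximations this is the fundamental theorem of calculus; the uniform bound `2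
* ‖h‖` lets dominated convergence pass to the limit. -/
theorem integral_resolventSemigroup {t : ℝ} (ht : 0 ≤ t) (h : X) :
    ∫ s in (0 : ℝ)..t, resolventSemigroup R s (h - R h) = R h - resolventSemigroup R t (R h) := by
  have h1 : Tendsto (fun n => ∫ s in (0 : ℝ)..t, expNeg (neumann R n) s (neumann R n (R h))) atTop
      (𝓝 (∫ s in (0 : ℝ)..t, resolventSemigroup R s (h - R h))) := by
    refine intervalIntegral.tendsto_integral_filter_of_dominated_convergence
      (fun _ => 2 * ‖h‖) (Eventually.of_forall fun n =>
        (continuous_expNeg _ _).aestronglyMeasurable) (Eventually.of_forall fun n =>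
        Eventually.of_forall fun s hs => ?_) intervalIntegrable_const
        (Eventually.of_forall fun s hs => ?_)
    · rw [uIoc_of_le ht] at hs
      exact (norm_expNeg_le (hR.neumann_nonneg n) hs.1.le _).trans (hR.norm_neumann_le n h)
    · rw [uIoc_of_le ht] at hs
      exact tendsto_apply_of_contraction
        (fun n x => norm_expNeg_le (hR.neumann_nonneg n) hs.1.le x)
        (hR.tendsto_resolventSemigroup hs.1.le _) (hR.tendsto_neumann h)
  have h2 := (hR.tendsto_resolventSemigroup ht (R h)).const_sub (R h)
  refine tendsto_nhds_unique h1 (h2.congr fun n => ?_)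
  have hd : ∀ s ∈ uIcc 0 t, HasDerivAt (fun s => expNeg (neumann R n) s (R h))
      (-(expNeg (neumann R n) s (neumann R n (R h)))) s := by
    intro s _
    refine (hasDerivAt_expNeg _ _ s).congr_deriv ?_
    congr 1
    exact DFunLike.congr_fun (commute_expNeg (Commute.refl _) s).eq (R h)
  have := intervalIntegral.integral_eq_sub_of_hasDerivAt hd
    ((continuous_expNeg _ _).neg.intervalIntegrable _ _)
  rw [intervalIntegral.integral_neg, expNeg_zero, one_apply_eq_self] at this
  rw [← neg_sub, ← this, neg_neg]

/-- Time integration regularises: the integrated orbit of any vector, in the domain or not, lies in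
the range of `R`. This is what later admits a forcing term outside the form space. -/
theorem integral_resolventSemigroup_eq {t : ℝ} (ht : 0 ≤ t) (h : X) :
    ∫ s in (0 : ℝ)..t, resolventSemigroup R s h =
      R ((∫ s in (0 : ℝ)..t, resolventSemigroup R s h) + h - resolventSemigroup R t h) := by
  have e : ∀ s, R (resolventSemigroup R s h) = resolventSemigroup R s (R h) := fun s =>
    DFunLike.congr_fun (hR.commute_resolventSemigroup s).eq h
  have hint : ∀ x, IntervalIntegrable (fun s => resolventSemigroup R s x) volume 0 t := fun x =>
    (hR.continuous_resolventSemigroup x).intervalIntegrable _ _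
  have h1 := hR.integral_resolventSemigroup ht h
  simp only [map_sub] at h1
  rw [intervalIntegral.integral_sub (hint _) (hint _)] at h1
  rw [map_sub, map_add, ← R.intervalIntegral_comp_comm (hint h)]
  simp only [e]
  rw [add_sub_assoc, ← h1]
  abel

theorem hasGenerator_of_eq {u w : X} (h : u = R (u - w)) :
    HasGenerator (resolventSemigroup R) u w := by
  set k := u - w
  have hw : k - R k = -w := by rw [← h]; simp [k]
  have hd : HasDerivAt (fun t => ∫ s in (0 : ℝ)..t, resolventSemigroup R s (k - R k))
      (k - R k) 0 := by
    have := ((hR.continuous_resolventSemigroup (k - R k)).integral_hasStrictDerivAt 0 0).hasDerivAt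
    rwa [hR.isC0Semigroup.zero] at this
  have hd2 := (hasDerivAt_iff_tendsto_slope.1 hd).mono_left
    (nhdsWithin_mono 0 (fun t (ht : 0 < t) => (ht.ne' : t ≠ 0)) : 𝓝[>] (0 : ℝ) ≤ _)
  have hd3 := hd2.neg
  rw [hw, neg_neg] at hd3
  refine hd3.congr' ?_
  filter_upwards [self_mem_nhdsWithin] with t (ht : 0 < t)
  rw [← hw, slope, hR.integral_resolventSemigroup ht.le, ← h]
  simp only [vsub_eq_sub, sub_zero, intervalIntegral.integral_same]
  rw [← smul_neg, neg_sub]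

/-- If `A u = w`, subtracting the known domain element `R (u - w)` leaves a vector `z` with `A z =
z`. The semigroup is contractive, so `⟪z, z⟫ ≤ 0` and the generator has no elements beyond the
expected ones. -/
theorem hasGenerator_iff {u w : X} :
    HasGenerator (resolventSemigroup R) u w ↔ u = R (u - w) := by
  refine ⟨fun h => ?_, hR.hasGenerator_of_eq⟩
  have h1 : HasGenerator (resolventSemigroup R) (R (u - w)) (R (u - w) - (u - w)) :=
    hR.hasGenerator_of_eq (by simp)
  have h2 := h.sub h1
  set z := u - R (u - w) with hz
  have e : w - (R (u - w) - (u - w)) = z := by rw [hz]; abel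
  rw [e] at h2
  have h3 : ⟪z, z⟫ ≤ 0 := by
    refine le_of_tendsto (Tendsto.inner h2 (tendsto_const_nhds (x := z))) ?_
    filter_upwards [self_mem_nhdsWithin] with t (ht : 0 < t)
    rw [real_inner_smul_left, inner_sub_left]
    have h4 := real_inner_le_norm (resolventSemigroup R t z) z
    have h5 := hR.norm_resolventSemigroup_le t z
    have h6 := real_inner_self_eq_norm_sq z
    have h7 : ⟪resolventSemigroup R t z, z⟫ - ⟪z, z⟫ ≤ 0 := by nlinarith [norm_nonneg z]
    exact mul_nonpos_of_nonneg_of_nonpos (inv_nonneg.2 ht.le) h7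
  rw [real_inner_self_eq_norm_sq] at h3
  exact sub_eq_zero.1 (norm_eq_zero.1 (by nlinarith [norm_nonneg z]))

omit [CompleteSpace X] in
theorem dissipative {u w : X} (h : u = R (u - w)) : ⟪w, u⟫ ≤ 0 := by
  set k := u - w
  have hw : w = R k - k := by rw [← h]; simp [k]
  have h1 := hR.compl_comp_nonneg k
  have h2 : ⟪w, u⟫ = -⟪(1 - R) k, R k⟫ := by
    rw [h, hw, ← inner_neg_left]; simp
  rw [h2, hR.compl_symm, real_inner_comm]
  linarith

end IsPosResolvent

end ContractionSemigroup

/-! ### Picard iteration and uniqueness for Duhamel equations. -/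

namespace ContractionSemigroup

section Picard

variable {V : Type*} [NormedAddCommGroup V] [NormedSpace ℝ V]
  {P : ℝ → V →L[ℝ] V}

/-- Strong continuity becomes joint continuity because the operators are uniformly bounded. -/
theorem continuous_uncurry_of_contraction (hP : ∀ t x, ‖P t x‖ ≤ ‖x‖)
    (hc : ∀ x, Continuous fun t => P t x) : Continuous fun p : ℝ × V => P p.1 p.2 := by
  rw [continuous_iff_continuousAt]
  rintro ⟨t, x⟩
  have h1 : Tendsto (fun p : ℝ × V => P p.1 (p.2 - x)) (𝓝 (t, x)) (𝓝 0) := by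
    refine squeeze_zero_norm (fun p => hP _ _) ?_
    have : Continuous fun p : ℝ × V => ‖p.2 - x‖ := by fun_prop
    simpa using this.tendsto (t, x)
  have h2 : Tendsto (fun p : ℝ × V => P p.1 x) (𝓝 (t, x)) (𝓝 (P t x)) :=
    ((hc x).comp continuous_fst).tendsto (t, x)
  have := h1.add h2
  rw [zero_add] at this
  exact this.congr fun p => by rw [map_sub, sub_add_cancel]

theorem continuous_duhamel (hP : ∀ t x, ‖P t x‖ ≤ ‖x‖)
    (hc : ∀ x, Continuous fun t => P t x) {F : ℝ → V} (hF : Continuous F) :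
    Continuous fun t => ∫ τ in (0 : ℝ)..t, P (t - τ) (F τ) := by
  refine intervalIntegral.continuous_parametric_intervalIntegral_of_continuous
    (f := fun t τ => P (t - τ) (F τ)) ?_ continuous_id
  exact (continuous_uncurry_of_contraction hP hc).comp
    ((continuous_fst.sub continuous_snd).prodMk (hF.comp continuous_snd))

theorem intervalIntegrable_duhamel (hP : ∀ t x, ‖P t x‖ ≤ ‖x‖)
    (hc : ∀ x, Continuous fun t => P t x) {F : ℝ → V} {t : ℝ} (ht : 0 ≤ t)
    (hF : ContinuousOn F (Icc 0 t)) :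
    IntervalIntegrable (fun τ => P (t - τ) (F τ)) volume 0 t := by
  refine ContinuousOn.intervalIntegrable_of_Icc ht ?_
  exact (continuous_uncurry_of_contraction hP hc).comp_continuousOn
    ((continuous_const.sub continuous_id).continuousOn.prodMk hF)

/-- Picard iteration for a locally Lipschitz perturbation of a contraction semigroup. -/
theorem exists_local_solution [CompleteSpace V] (hP : ∀ t x, ‖P t x‖ ≤ ‖x‖)
    (hc : ∀ x, Continuous fun t => P t x) {f : V → V} (hf : LocallyLipschitz f) {b : ℝ → V}
    (hb : Continuous b) :
    ∃ T : ℝ, 0 < T ∧ ∃ u : ℝ → V, Continuous u ∧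
      ∀ t ∈ Icc 0 T, u t = b t - ∫ τ in (0 : ℝ)..t, P (t - τ) (f (u τ)) := by
  obtain ⟨K, s, hs, hK⟩ := hf (b 0)
  obtain ⟨r, hr, hrs⟩ := Metric.nhds_basis_closedBall.mem_iff.1 hs
  obtain ⟨δ, hδ, hbδ⟩ := Metric.continuous_iff.1 hb 0 (r / 2) (by positivity)
  set M : ℝ := ‖f (b 0)‖ + K * r with hM
  have hM0 : 0 ≤ M := by positivity
  -- The first two bounds keep the iteration in the ball of radius `r`: `b` moves by less than
  -- `r/2`, and the integral, whose integrand is bounded by `M`, by at most `r/2`. The third gives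
  -- contraction factor `1/2`.
  obtain ⟨T, hT, hT1, hT2, hT3⟩ : ∃ T : ℝ, 0 < T ∧ T < δ ∧ T * M ≤ r / 2 ∧ K * T ≤ 1 / 2 := by
    refine ⟨min (δ / 2) (min (r / 2 / (M + 1)) (1 / 2 / (K + 1))), by positivity, ?_, ?_, ?_⟩
    · exact (min_le_left _ _).trans_lt (by linarith)
    · have h1 : min (δ / 2) (min (r / 2 / (M + 1)) (1 / 2 / ((K : ℝ) + 1))) ≤ r / 2 / (M + 1) :=
        (min_le_right _ _).trans (min_le_left _ _)
      refine (mul_le_mul_of_nonneg_right h1 hM0).trans ?_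
      rw [div_mul_eq_mul_div, div_le_iff₀ (by positivity)]
      nlinarith
    · have h1 : min (δ / 2) (min (r / 2 / (M + 1)) (1 / 2 / ((K : ℝ) + 1))) ≤
          1 / 2 / ((K : ℝ) + 1) := (min_le_right _ _).trans (min_le_right _ _)
      refine (mul_le_mul_of_nonneg_left h1 K.coe_nonneg).trans ?_
      rw [mul_div_assoc', div_le_iff₀ (by positivity)]
      have := K.coe_nonneg
      nlinarith
  let ext : C(Icc 0 T, V) → ℝ → V := fun w => IccExtend hT.le w
  have hext : ∀ w, Continuous (ext w) := fun w => w.continuous.Icc_extend'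
  let Φ : C(Icc 0 T, V) → C(Icc 0 T, V) := fun w =>
    ⟨fun t => b t - ∫ τ in (0 : ℝ)..t, P (t - τ) (f (ext w τ)),
      (hb.comp continuous_subtype_val).sub
        ((continuous_duhamel hP hc (hf.continuous.comp (hext w))).comp continuous_subtype_val)⟩
  let w₀ : C(Icc 0 T, V) := ContinuousMap.const _ (b 0)
  have hmem : ∀ w ∈ Metric.closedBall w₀ r, ∀ τ, ext w τ ∈ Metric.closedBall (b 0) r := by
    intro w hw τ
    exact (ContinuousMap.dist_le hr.le).1 hw (projIcc 0 T hT.le τ)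
  have hlip : ∀ w ∈ Metric.closedBall w₀ r, ∀ w' ∈ Metric.closedBall w₀ r,
      dist (Φ w) (Φ w') ≤ (1 / 2) * dist w w' := by
    intro w hw w' hw'
    refine (ContinuousMap.dist_le (by positivity)).2 fun t => ?_
    have hint : ∀ w, IntervalIntegrable (fun τ => P (t - τ) (f (ext w τ))) volume 0 t := fun w =>
      intervalIntegrable_duhamel hP hc t.2.1 (hf.continuous.comp (hext w)).continuousOn
    have e : dist (Φ w t) (Φ w' t) =
        ‖∫ τ in (0 : ℝ)..t, P (t - τ) (f (ext w τ) - f (ext w' τ))‖ := by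
      simp only [map_sub]
      rw [intervalIntegral.integral_sub (hint w) (hint w'), dist_eq_norm, norm_sub_rev]
      simp only [Φ, ContinuousMap.coe_mk]
      congr 1
      abel
    rw [e]
    have hbd : ∀ τ ∈ uIoc (0 : ℝ) t,
        ‖P (t - τ) (f (ext w τ) - f (ext w' τ))‖ ≤ K * dist w w' := by
      intro τ _
      refine (hP _ _).trans ?_
      rw [← dist_eq_norm]
      refine (hK.dist_le_mul _ (hrs (hmem w hw τ)) _ (hrs (hmem w' hw' τ))).trans ?_
      exact mul_le_mul_of_nonneg_left (ContinuousMap.dist_apply_le_dist _) K.coe_nonneg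
    refine (intervalIntegral.norm_integral_le_of_norm_le_const hbd).trans ?_
    rw [sub_zero, abs_of_nonneg t.2.1]
    have h1 : (K : ℝ) * t ≤ 1 / 2 :=
      (mul_le_mul_of_nonneg_left t.2.2 K.coe_nonneg).trans hT3
    nlinarith [dist_nonneg (x := w) (y := w')]
  have hmaps : MapsTo Φ (Metric.closedBall w₀ r) (Metric.closedBall w₀ r) := by
    intro w hw
    refine (ContinuousMap.dist_le hr.le).2 fun t => ?_
    have hbd : ∀ τ ∈ uIoc (0 : ℝ) t, ‖P (t - τ) (f (ext w τ))‖ ≤ M := by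
      intro τ _
      refine (hP _ _).trans ?_
      have h1 := hK.dist_le_mul _ (hrs (hmem w hw τ)) _ (hrs (Metric.mem_closedBall_self hr.le))
      have h2 : (K : ℝ) * dist (ext w τ) (b 0) ≤ K * r :=
        mul_le_mul_of_nonneg_left (hmem w hw τ) K.coe_nonneg
      rw [dist_eq_norm] at h1
      have := norm_le_norm_add_norm_sub' (f (ext w τ)) (f (b 0))
      linarith
    have h1 := intervalIntegral.norm_integral_le_of_norm_le_const hbd
    rw [sub_zero, abs_of_nonneg t.2.1] at h1
    have h2 : M * t ≤ r / 2 := by nlinarith [t.2.2]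
    have h3 : dist (b t) (b 0) < r / 2 := by
      refine hbδ _ ?_
      rw [Real.dist_eq, sub_zero, abs_of_nonneg t.2.1]
      exact t.2.2.trans_lt hT1
    simp only [Φ, w₀, ContinuousMap.coe_mk, ContinuousMap.const_apply]
    rw [dist_eq_norm] at h3 ⊢
    have h4 := norm_sub_le (b t - b 0) (∫ τ in (0 : ℝ)..t, P (t - τ) (f (ext w τ)))
    rw [sub_right_comm]
    linarith
  have hcon : ContractingWith (1 / 2) (hmaps.restrict Φ _ _) := by
    refine ⟨by norm_num, LipschitzWith.of_dist_le_mul fun w w' => ?_⟩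
    have : dist (Φ w) (Φ w') ≤ ((1 / 2 : NNReal) : ℝ) * dist (w : C(Icc 0 T, V)) w' := by
      simpa using hlip w w.2 w' w'.2
    exact this
  obtain ⟨w, hw, hfix, -⟩ := hcon.exists_fixedPoint' Metric.isClosed_closedBall.isComplete hmaps
    (Metric.mem_closedBall_self hr.le) (edist_ne_top _ _)
  refine ⟨T, hT, ext w, hext w, fun t ht => ?_⟩
  have := DFunLike.congr_fun hfix.eq ⟨t, ht⟩
  simp only [Φ, ContinuousMap.coe_mk] at this
  rw [this]
  simp only [ext]
  rw [IccExtend_of_mem _ _ ht]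

theorem eqOn_of_duhamel (hP : ∀ t x, ‖P t x‖ ≤ ‖x‖) (hc : ∀ x, Continuous fun t => P t x)
    {f : V → V} (hf : LocallyLipschitz f) {b u v : ℝ → V} {T : ℝ} (hT : 0 ≤ T)
    (hu : ContinuousOn u (Icc 0 T)) (hv : ContinuousOn v (Icc 0 T))
    (hu' : ∀ t ∈ Icc 0 T, u t = b t - ∫ τ in (0 : ℝ)..t, P (t - τ) (f (u τ)))
    (hv' : ∀ t ∈ Icc 0 T, v t = b t - ∫ τ in (0 : ℝ)..t, P (t - τ) (f (v τ))) :
    EqOn v u (Icc 0 T) := by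
  -- Both trajectories are compact, so a single Lipschitz constant serves on their union, whatever
  -- the length of the interval.
  obtain ⟨K, hK⟩ := (hf.locallyLipschitzOn (s := u '' Icc 0 T ∪ v '' Icc 0 T)
    ).exists_lipschitzOnWith_of_compact
    ((isCompact_Icc.image_of_continuousOn hu).union (isCompact_Icc.image_of_continuousOn hv))
  let d : ℝ → ℝ := IccExtend hT (fun t : Icc 0 T => ‖u t - v t‖)
  have hdc : Continuous d :=
    Continuous.Icc_extend' ((continuousOn_iff_continuous_domRestrict.1 hu).sub
      (continuousOn_iff_continuous_domRestrict.1 hv)).norm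
  have hd : ∀ t ∈ Icc 0 T, d t = ‖u t - v t‖ := fun t ht => IccExtend_of_mem _ _ ht
  have hd0 : ∀ t, 0 ≤ d t := fun t => norm_nonneg _
  have hle : ∀ t ∈ Icc 0 T, d t ≤ K * ∫ τ in (0 : ℝ)..t, d τ := by
    intro t ht
    have hsub : Icc 0 t ⊆ Icc 0 T := Icc_subset_Icc_right ht.2
    have hi1 : IntervalIntegrable (fun τ => P (t - τ) (f (u τ))) volume 0 t :=
      intervalIntegrable_duhamel hP hc ht.1 (hf.continuous.comp_continuousOn (hu.mono hsub))
    have hi2 : IntervalIntegrable (fun τ => P (t - τ) (f (v τ))) volume 0 t :=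
      intervalIntegrable_duhamel hP hc ht.1 (hf.continuous.comp_continuousOn (hv.mono hsub))
    rw [hd t ht, hu' t ht, hv' t ht, sub_sub_sub_cancel_left, norm_sub_rev]
    rw [← intervalIntegral.integral_sub hi1 hi2, ← intervalIntegral.integral_const_mul]
    refine intervalIntegral.norm_integral_le_of_norm_le ht.1 (Eventually.of_forall fun τ hτ => ?_)
      ((continuous_const.mul hdc).intervalIntegrable _ _)
    have hτ' : τ ∈ Icc 0 T := hsub ⟨hτ.1.le, hτ.2⟩
    rw [← map_sub, hd τ hτ', ← dist_eq_norm (u τ)]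
    refine (hP _ _).trans ?_
    rw [← dist_eq_norm]
    exact hK.dist_le_mul _ (Or.inl ⟨τ, hτ', rfl⟩) _ (Or.inr ⟨τ, hτ', rfl⟩)
  have hderiv : ∀ t, HasDerivAt (fun t => ∫ τ in (0 : ℝ)..t, d τ) (d t) t := fun t =>
    (hdc.integral_hasStrictDerivAt 0 t).hasDerivAt
  -- Gronwall is applied to the primitive of `d`, which is differentiable even though `d` need not
  -- be.
  have hzero : ∀ t ∈ Icc 0 T, ‖∫ τ in (0 : ℝ)..t, d τ‖ ≤ gronwallBound 0 K 0 (t - 0) := by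
    refine norm_le_gronwallBound_of_norm_deriv_right_le
      (fun t _ => (hderiv t).continuousAt.continuousWithinAt)
      (fun t _ => (hderiv t).hasDerivWithinAt) (by simp) fun t ht => ?_
    rw [add_zero, Real.norm_of_nonneg (hd0 t)]
    exact (hle t ⟨ht.1, ht.2.le⟩).trans
      (mul_le_mul_of_nonneg_left (Real.le_norm_self _) K.coe_nonneg)
  intro t ht
  have h1 := hzero t ht
  rw [gronwallBound_ε0_δ0] at h1
  have h2 := hle t ht
  rw [norm_le_zero_iff.1 h1, mul_zero, hd t ht] at h2
  exact (sub_eq_zero.1 (norm_le_zero_iff.1 h2)).symm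

end Picard

/-! ### Semigroups on `H` and `V` attached to a dense embedding. -/

section Form

open scoped RealInnerProductSpace

variable {H V : Type*} [NormedAddCommGroup H] [InnerProductSpace ℝ H] [CompleteSpace H]
  [NormedAddCommGroup V] [InnerProductSpace ℝ V] [CompleteSpace V] {j : V →L[ℝ] H}

open ContinuousLinearMap (adjoint adjoint_inner_left adjoint_inner_right)

/-- The form of `j j*` at `x` is `‖j* x‖ ^ 2`, and `j*` is injective because `j` has dense range. -/
theorem isPosResolvent_comp_adjoint (hj : ∀ U, ‖j U‖ ≤ ‖U‖) (hd : DenseRange j) :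
    IsPosResolvent (j.comp (adjoint j)) where
  symm x y := by
    simp only [ContinuousLinearMap.comp_apply]
    rw [← adjoint_inner_right j, ← adjoint_inner_left j]
  nonneg x := by
    simp only [ContinuousLinearMap.comp_apply]
    rw [← adjoint_inner_right]
    exact real_inner_self_nonneg
  le x := by
    have h1 := hj (adjoint j x)
    have h2 : ⟪j (adjoint j x), x⟫ = ‖adjoint j x‖ ^ 2 := by
      rw [← adjoint_inner_right, real_inner_self_eq_norm_sq]
    have h3 := real_inner_le_norm (j (adjoint j x)) x
    simp only [ContinuousLinearMap.comp_apply]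
    rw [h2] at h3 ⊢
    rw [real_inner_self_eq_norm_sq]
    have h4 : ‖adjoint j x‖ ^ 2 ≤ ‖adjoint j x‖ * ‖x‖ :=
      h3.trans (mul_le_mul_of_nonneg_right h1 (norm_nonneg _))
    nlinarith [norm_nonneg x, norm_nonneg (adjoint j x), sq_nonneg (‖x‖ - ‖adjoint j x‖)]
  inj x hx := by
    simp only [ContinuousLinearMap.comp_apply] at hx
    have h2 : ‖adjoint j x‖ ^ 2 = 0 := by
      rw [← real_inner_self_eq_norm_sq, adjoint_inner_right, hx, inner_zero_left]
    have h3 : adjoint j x = 0 := norm_eq_zero.1 (pow_eq_zero_iff (two_ne_zero) |>.1 h2)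
    refine hd.eq_zero_of_inner_left ℝ fun v => ?_
    rw [← adjoint_inner_left, h3, inner_zero_left]

/-- The counterpart on `V`: here the form is `‖j x‖ ^ 2`, and injectivity of `j` replaces density of
its range. -/
theorem isPosResolvent_adjoint_comp (hj : ∀ U, ‖j U‖ ≤ ‖U‖) (hi : Function.Injective j) :
    IsPosResolvent ((adjoint j).comp j) where
  symm x y := by
    simp only [ContinuousLinearMap.comp_apply]
    rw [adjoint_inner_left, adjoint_inner_right]
  nonneg x := by
    simp only [ContinuousLinearMap.comp_apply]
    rw [adjoint_inner_left]
    exact real_inner_self_nonneg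
  le x := by
    simp only [ContinuousLinearMap.comp_apply]
    rw [adjoint_inner_left, real_inner_self_eq_norm_sq, real_inner_self_eq_norm_sq]
    exact pow_le_pow_left₀ (norm_nonneg _) (hj x) 2
  inj x hx := by
    simp only [ContinuousLinearMap.comp_apply] at hx
    have h2 : ‖j x‖ ^ 2 = 0 := by
      rw [← real_inner_self_eq_norm_sq, ← adjoint_inner_left, hx, inner_zero_left]
    have h3 : j x = 0 := norm_eq_zero.1 (pow_eq_zero_iff (two_ne_zero) |>.1 h2)
    exact hi (h3.trans (map_zero j).symm)

/-- The semigroups on the two spaces are intertwined by the embedding. -/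
theorem resolventSemigroup_intertwine (hj : ∀ U, ‖j U‖ ≤ ‖U‖) (hi : Function.Injective j)
    (hd : DenseRange j) {t : ℝ} (ht : 0 ≤ t) (U : V) :
    resolventSemigroup (j.comp (adjoint j)) t (j U) =
      j (resolventSemigroup ((adjoint j).comp j) t U) := by
  have hRH := isPosResolvent_comp_adjoint hj hd
  have hRV := isPosResolvent_adjoint_comp hj hi
  set S := resolventSemigroup (j.comp (adjoint j))
  set P := resolventSemigroup ((adjoint j).comp j)
  -- Applying `j` to `U = j* j (U - W)` gives `j U = j j* (j U - j W)`, so `j` carries one generator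
  -- into the other.
  have hgen : ∀ U W, HasGenerator P U W → HasGenerator S (j U) (j W) := by
    intro U W h
    rw [hRV.hasGenerator_iff] at h
    rw [hRH.hasGenerator_iff, ← map_sub]
    conv_lhs => rw [h]
    rfl
  refine congrFun (Continuous.ext_on hRV.dense_range ((S t).continuous.comp j.continuous)
    (j.continuous.comp (P t).continuous) ?_) U
  rintro _ ⟨K, rfl⟩
  set U := ((adjoint j).comp j) K
  have hU : HasGenerator P U (U - K) := hRV.hasGenerator_iff.2 (by simp [U])
  refine sub_eq_zero.1 (eq_zero_of_dissipative (y := fun s => S s (j U) - j (P s U))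
    (w := fun s => S s (j (U - K)) - j (P s (U - K))) ?_ ?_ ?_ ?_ ht)
  · exact (hRH.isC0Semigroup.cont _).sub
      (j.continuous.comp_continuousOn (hRV.isC0Semigroup.cont _))
  · intro s hs
    exact (hRH.isC0Semigroup.hasDerivWithinAt (hgen _ _ hU) hs).sub
      (j.hasFDerivAt.comp_hasDerivWithinAt s (hRV.isC0Semigroup.hasDerivWithinAt hU hs))
  · intro s hs
    refine hRH.dissipative (hRH.hasGenerator_iff.1 ?_)
    exact (hRH.isC0Semigroup.hasGenerator_apply (hgen _ _ hU) hs).sub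
      (hgen _ _ (hRV.isC0Semigroup.hasGenerator_apply hU hs))
  · simp [S, P, hRH.isC0Semigroup.zero, hRV.isC0Semigroup.zero]

/-- Local existence and uniqueness of mild solutions for a semigroup given by a form on `V`. The
nonlinearity takes values in `V`, the constant forcing only in `H`. -/
theorem exists_unique_mild_solution (hj : ∀ U, ‖j U‖ ≤ ‖U‖) (hi : Function.Injective j)
    (hd : DenseRange j) {c : ℝ} (hc : 0 < c) {G : H → H → Prop}
    (hG : ∀ u w, G u w ↔ u = j (adjoint j (u - c⁻¹ • w)))
    {f : V → V} (hf : LocallyLipschitz f) (g : H) (u₀ : V) {IsMild : ℝ → (ℝ → V) → Prop}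
    (hmild : ∀ T u, IsMild T u ↔ ContinuousOn u (Icc 0 T) ∧ ∃ S : ℝ → H →L[ℝ] H,
      IsC0Semigroup S ∧ (∀ u w, HasGenerator S u w ↔ G u w) ∧ ∀ t ∈ Icc 0 T,
        j (u t) = S t (j u₀) - ∫ τ in (0 : ℝ)..t, S (t - τ) (j (f (u τ)) - g)) :
    ∃ T₀ : ℝ, 0 < T₀ ∧ ∀ T : ℝ, 0 < T → T ≤ T₀ →
      ∃ u : ℝ → V, IsMild T u ∧ ∀ v : ℝ → V, IsMild T v → EqOn v u (Icc 0 T) := by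
  have hRH := isPosResolvent_comp_adjoint hj hd
  have hRV := isPosResolvent_adjoint_comp hj hi
  set S₁ := resolventSemigroup (j.comp (adjoint j)) with hS₁
  -- Running time at speed `c` turns the generator `1 - R⁻¹` into `c (1 - R⁻¹)`.
  set S : ℝ → H →L[ℝ] H := fun t => S₁ (c * t) with hSdef
  set P : ℝ → V →L[ℝ] V := fun t => resolventSemigroup ((adjoint j).comp j) (c * t) with hPdef
  have hP : ∀ t x, ‖P t x‖ ≤ ‖x‖ := fun t x => hRV.norm_resolventSemigroup_le _ x
  have hPc : ∀ x, Continuous fun t => P t x := fun x =>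
    (hRV.continuous_resolventSemigroup x).comp (continuous_const.mul continuous_id)
  have hSn : ∀ t x, ‖S t x‖ ≤ ‖x‖ := fun t x => hRH.norm_resolventSemigroup_le _ x
  have hSc : ∀ x, Continuous fun t => S t x := fun x =>
    (hRH.continuous_resolventSemigroup x).comp (continuous_const.mul continuous_id)
  have hSP : ∀ t, 0 ≤ t → ∀ U, S t (j U) = j (P t U) := fun t ht U =>
    resolventSemigroup_intertwine hj hi hd (mul_nonneg hc.le ht) U
  have hS : IsC0Semigroup S := by
    refine ⟨?_, fun s t hs ht => ?_, fun u => (hSc u).continuousOn⟩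
    · simp only [hSdef, mul_zero]
      exact hRH.isC0Semigroup.zero
    · simp only [hSdef, mul_add]
      exact hRH.isC0Semigroup.add _ _ (mul_nonneg hc.le hs) (mul_nonneg hc.le ht)
  have hSgen : ∀ u w, HasGenerator S u w ↔ G u w := by
    intro u w
    rw [hG]
    refine Iff.trans ?_ (hRH.hasGenerator_iff (u := u) (w := c⁻¹ • w))
    have hscale : ∀ a : ℝ, 0 < a → Tendsto (fun t : ℝ => a * t) (𝓝[>] 0) (𝓝[>] 0) := by
      intro a ha
      refine tendsto_nhdsWithin_iff.2 ⟨?_, ?_⟩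
      · have : Tendsto (fun t : ℝ => a * t) (𝓝 0) (𝓝 (a * 0)) :=
          (continuous_const.mul continuous_id).tendsto 0
        rw [mul_zero] at this
        exact this.mono_left nhdsWithin_le_nhds
      · filter_upwards [self_mem_nhdsWithin] with t (ht : 0 < t)
        exact mul_pos ha ht
    constructor
    · intro h
      have := (Tendsto.comp h (hscale c⁻¹ (inv_pos.2 hc))).const_smul c⁻¹
      refine this.congr fun t => ?_
      simp only [Function.comp_apply, hSdef, mul_inv_cancel_left₀ hc.ne', smul_smul, mul_inv,
        inv_inv]
      rw [inv_mul_cancel_left₀ hc.ne']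
    · intro h
      have := (Tendsto.comp h (hscale c hc)).const_smul c
      rw [smul_inv_smul₀ hc.ne'] at this
      refine this.congr fun t => ?_
      simp only [Function.comp_apply, hSdef, smul_smul, mul_inv]
      rw [mul_inv_cancel_left₀ hc.ne']
  -- A mild solution may come with its own semigroup, so two solutions can be compared only once the
  -- semigroup is known to be unique.
  have huniq : ∀ S' : ℝ → H →L[ℝ] H, IsC0Semigroup S' → (∀ u w, HasGenerator S' u w ↔ G u w) →
      ∀ t, 0 ≤ t → S' t = S t := by
    intro S' hS' hG' t ht
    refine hS'.unique hS (fun u w h => (hSgen u w).2 ((hG' u w).1 h)) ?_ ?_ ht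
    · intro u w h
      have h1 := hRH.dissipative ((hG u w).1 ((hSgen u w).1 h))
      rw [real_inner_smul_left] at h1
      exact nonpos_of_mul_nonpos_right h1 (inv_pos.2 hc)
    · refine hRH.dense_range.mono ?_
      rintro _ ⟨k, rfl⟩
      refine ⟨c • ((j.comp (adjoint j)) k - k), (hG' _ _).2 ((hG _ _).2 ?_)⟩
      rw [inv_smul_smul₀ hc.ne', sub_sub_cancel]
      rfl
  -- The lift to `V` of the integrated orbit of `g`: the outer `j` of `R = j j*` is stripped from
  -- `integral_resolventSemigroup_eq`, and `c⁻¹` comes from the change of time.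
  let N : ℝ → V := fun t =>
    c⁻¹ • adjoint j ((∫ τ in (0 : ℝ)..(c * t), S₁ τ g) + g - S₁ (c * t) g)
  have hNc : Continuous N := by
    have h1 := hRH.continuous_resolventSemigroup g
    have h2 : Continuous fun t => ∫ τ in (0 : ℝ)..t, S₁ τ g :=
      intervalIntegral.continuous_primitive (fun a b => h1.intervalIntegrable a b) 0
    have h3 : Continuous fun t : ℝ => c * t := continuous_const.mul continuous_id
    exact ((adjoint j).continuous.comp
      (((h2.comp h3).add continuous_const).sub (h1.comp h3))).const_smul _
  have hN : ∀ t, 0 ≤ t → j (N t) = ∫ τ in (0 : ℝ)..t, S τ g := by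
    intro t ht
    have h1 := hRH.integral_resolventSemigroup_eq (mul_nonneg hc.le ht) g
    have h2 : ∫ τ in (0 : ℝ)..t, S τ g = c⁻¹ • ∫ τ in (0 : ℝ)..(c * t), S₁ τ g := by
      have := intervalIntegral.integral_comp_mul_left (fun τ => S₁ τ g) hc.ne' (a := 0) (b := t)
      rwa [mul_zero] at this
    rw [h2, h1, map_smul]
    rfl
  have hequiv : ∀ u : ℝ → V, ∀ t, 0 ≤ t → ContinuousOn u (Icc 0 t) →
      (j (u t) = S t (j u₀) - ∫ τ in (0 : ℝ)..t, S (t - τ) (j (f (u τ)) - g) ↔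
        u t = (P t u₀ + N t) - ∫ τ in (0 : ℝ)..t, P (t - τ) (f (u τ))) := by
    intro u t ht hu
    have hfu : ContinuousOn (fun τ => f (u τ)) (Icc 0 t) := hf.continuous.comp_continuousOn hu
    have hi1 := intervalIntegrable_duhamel hP hPc ht hfu
    have hi2 := intervalIntegrable_duhamel hSn hSc ht (j.continuous.comp_continuousOn hfu)
    have hi3 := intervalIntegrable_duhamel hSn hSc ht (continuousOn_const (c := g))
    have e1 : ∫ τ in (0 : ℝ)..t, S (t - τ) (j (f (u τ))) =
        j (∫ τ in (0 : ℝ)..t, P (t - τ) (f (u τ))) := by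
      rw [← j.intervalIntegral_comp_comm hi1]
      refine intervalIntegral.integral_congr fun τ hτ => ?_
      rw [uIcc_of_le ht] at hτ
      exact hSP _ (sub_nonneg.2 hτ.2) _
    have e2 : ∫ τ in (0 : ℝ)..t, S (t - τ) g = j (N t) := by
      rw [hN t ht, intervalIntegral.integral_comp_sub_left (fun τ => S τ g), sub_self, sub_zero]
    have e3 : ∫ τ in (0 : ℝ)..t, S (t - τ) (j (f (u τ)) - g) =
        j (∫ τ in (0 : ℝ)..t, P (t - τ) (f (u τ))) - j (N t) := by
      simp only [map_sub]
      rw [← e1, ← e2]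
      exact intervalIntegral.integral_sub hi2 hi3
    rw [e3, hSP t ht, ← map_sub, ← map_sub, hi.eq_iff]
    rw [show ∀ a b d : V, a - (b - d) = a + d - b from fun a b d => by abel]
  have hbc : Continuous fun t => P t u₀ + N t := (hPc u₀).add hNc
  obtain ⟨T₀, hT₀, u, hu, hu'⟩ := exists_local_solution hP hPc hf hbc
  refine ⟨T₀, hT₀, fun T hT hTT => ⟨u, (hmild T u).2 ⟨hu.continuousOn, S, hS, hSgen,
    fun t ht => (hequiv u t ht.1 hu.continuousOn).2 (hu' t ⟨ht.1, ht.2.trans hTT⟩)⟩, ?_⟩⟩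
  intro v hv
  obtain ⟨hvc, S', hS', hG', hv'⟩ := (hmild T v).1 hv
  refine eqOn_of_duhamel hP hPc hf hT.le hu.continuousOn hvc
    (fun t ht => hu' t ⟨ht.1, ht.2.trans hTT⟩) fun t ht => ?_
  refine (hequiv v t ht.1 (hvc.mono (Icc_subset_Icc_right ht.2))).1 ?_
  rw [hv' t ht, huniq S' hS' hG' t ht.1]
  congr 1
  refine intervalIntegral.integral_congr fun τ hτ => ?_
  rw [uIcc_of_le ht.1] at hτ
  simp only [huniq S' hS' hG' _ (sub_nonneg.2 hτ.2)]

end Form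

end ContractionSemigroup

/-! ### Test functions, difference quotients and the singular integral. -/

namespace FracDiffusion

/-- An integrable kernel dominating the singular integrals of smooth functions. -/
noncomputable def kernel (α h : ℝ) : ℝ := min (h ^ 2) 1 / |h| ^ (1 + α)

theorem kernel_nonneg (α h : ℝ) : 0 ≤ kernel α h := by
  unfold kernel; positivity

theorem kernel_neg (α h : ℝ) : kernel α (-h) = kernel α h := by
  simp [kernel]

/-- Near the origin the kernel is `|h| ^ (1 - α)`, integrable as `α < 2`; at infinity it is `|h| ^
(-1 - α)`, integrable as `α > 0`. -/
theorem integrable_kernel {α : ℝ} (h0 : 0 < α) (h2 : α < 2) : Integrable (kernel α) := by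
  have hIoi : IntegrableOn (kernel α) (Ioi 0) := by
    rw [← Ioc_union_Ioi_eq_Ioi (zero_le_one (α := ℝ))]
    refine IntegrableOn.union ?_ ?_
    · have h1 : IntegrableOn (fun h : ℝ => h ^ (1 - α)) (Ioc 0 1) :=
        (intervalIntegrable_iff_integrableOn_Ioc_of_le zero_le_one).1
          (intervalIntegral.intervalIntegrable_rpow' (by linarith))
      refine h1.congr_fun (fun h hh => ?_) measurableSet_Ioc
      have hp : 0 < h := hh.1
      have hm : min (h ^ 2) 1 = h ^ (2 : ℝ) := by
        rw [Real.rpow_two, min_eq_left (pow_le_one₀ hp.le hh.2)]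
      simp only [kernel]
      rw [hm, abs_of_pos hp, ← Real.rpow_sub hp]
      congr 1; ring
    · have h1 : IntegrableOn (fun h : ℝ => h ^ (-(1 + α))) (Ioi 1) :=
        integrableOn_Ioi_rpow_of_lt (by linarith) one_pos
      refine h1.congr_fun (fun h (hh : 1 < h) => ?_) measurableSet_Ioi
      have hp : 0 < h := one_pos.trans hh
      simp only [kernel]
      rw [min_eq_right (one_le_pow₀ hh.le), abs_of_pos hp, Real.rpow_neg hp.le, one_div]
  have hIio : IntegrableOn (kernel α) (Iio 0) := by
    have h1 := hIoi.integrable_indicator measurableSet_Ioi |>.comp_neg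
    rw [← integrable_indicator_iff measurableSet_Iio]
    refine h1.congr (Eventually.of_forall fun h => ?_)
    simp [indicator, kernel_neg]
  rw [← integrableOn_univ, ← Iic_union_Ioi (a := (0 : ℝ))]
  exact ((integrableOn_Iic_iff_integrableOn_Iio (by simp)).2 hIio).union hIoi

namespace IsTestFunction

variable {φ : ℝ → ℝ}

theorem continuous (hφ : IsTestFunction φ) : Continuous φ := hφ.1.continuous

theorem eq_zero (hφ : IsTestFunction φ) {x : ℝ} (hx : x ∉ Om) : φ x = 0 :=
  image_eq_zero_of_notMem_tsupport fun h => hx (hφ.2.2 h)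

theorem integrable (hφ : IsTestFunction φ) : Integrable φ :=
  hφ.continuous.integrable_of_hasCompactSupport hφ.2.1

theorem exists_bounds (hφ : IsTestFunction φ) : ∃ M : ℝ, 0 ≤ M ∧
    (∀ x, |φ x| ≤ M) ∧ (∀ x y, |φ x - φ y| ≤ M) ∧
    (∀ x h, (φ x - φ (x + h)) ^ 2 ≤ M * min (h ^ 2) 1) ∧
    ∀ x h, |2 * φ x - φ (x + h) - φ (x - h)| ≤ M * min (h ^ 2) 1 := by
  obtain ⟨B, hB⟩ := hφ.2.1.exists_bound_of_continuous hφ.continuous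
  obtain ⟨K, hK⟩ := ContDiff.lipschitzWith_of_hasCompactSupport hφ.2.1 hφ.1 (by simp)
  have hd : ContDiff ℝ ∞ (deriv φ) := (contDiff_infty_iff_deriv.1 hφ.1).2
  obtain ⟨K', hK'⟩ := ContDiff.lipschitzWith_of_hasCompactSupport hφ.2.1.deriv hd (by simp)
  have hdiff : Differentiable ℝ φ := hφ.1.differentiable (by simp)
  have hB0 : 0 ≤ B := (norm_nonneg _).trans (hB 0)
  have hK0 : (0 : ℝ) ≤ K := K.coe_nonneg
  have hK0' : (0 : ℝ) ≤ K' := K'.coe_nonneg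
  simp only [Real.norm_eq_abs] at hB
  have hdiffle : ∀ x y, |φ x - φ y| ≤ 2 * B := fun x y => by
    have := abs_sub (φ x) (φ y)
    linarith [hB x, hB y]
  -- The function `s ↦ φ (x + s) + φ (x - s)` has derivative `φ' (x + s) - φ' (x - s)`, at most `2
  -- K' s` in modulus since `φ'` is Lipschitz.
  have hsecond : ∀ x h, 0 ≤ h → |2 * φ x - φ (x + h) - φ (x - h)| ≤ 2 * K' * h ^ 2 := by
    intro x h hh
    have hD : ∀ s ∈ Icc 0 h, HasDerivWithinAt (fun s => φ (x + s) + φ (x - s))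
        (deriv φ (x + s) - deriv φ (x - s)) (Icc 0 h) s := by
      intro s _
      have h1 : HasDerivAt (fun s => φ (x + s)) (deriv φ (x + s)) s := by
        simpa using (hdiff (x + s)).hasDerivAt.comp_const_add x s
      have h2 : HasDerivAt (fun s => φ (x - s)) (-deriv φ (x - s)) s := by
        simpa using (hdiff (x - s)).hasDerivAt.comp_const_sub x s
      exact (h1.add h2).hasDerivWithinAt
    have := norm_image_sub_le_of_norm_deriv_le_segment' (C := 2 * K' * h) hD (fun s hs => ?_) h
      ⟨hh, le_rfl⟩
    · rw [Real.norm_eq_abs, abs_sub_comm] at this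
      simp only [add_zero, sub_zero] at this
      rw [show 2 * φ x - φ (x + h) - φ (x - h) = φ x + φ x - (φ (x + h) + φ (x - h)) by ring]
      refine this.trans (le_of_eq ?_)
      ring
    · rw [← dist_eq_norm]
      refine (hK'.dist_le_mul _ _).trans ?_
      rw [Real.dist_eq, show x + s - (x - s) = 2 * s by ring, abs_of_nonneg (by linarith [hs.1])]
      nlinarith [hs.1, hs.2]
  have hsecond' : ∀ x h, |2 * φ x - φ (x + h) - φ (x - h)| ≤ 2 * K' * h ^ 2 := by
    intro x h
    rcases le_total 0 h with hh | hh
    · exact hsecond x h hh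
    · have := hsecond x (-h) (by linarith)
      rw [sub_neg_eq_add, ← sub_eq_add_neg, neg_sq, sub_right_comm] at this
      exact this
  set M : ℝ := 4 * B + 4 * B ^ 2 + K ^ 2 + 2 * K' with hM
  have hmin : ∀ a h : ℝ, a ≤ M * h ^ 2 → a ≤ M → a ≤ M * min (h ^ 2) 1 := by
    intro a h h1 h2
    rcases min_choice (h ^ 2) 1 with e | e <;> rw [e]
    · exact h1
    · linarith
  have hMK : (K : ℝ) ^ 2 ≤ M := by rw [hM]; nlinarith
  have hMB : 4 * B ≤ M := by rw [hM]; nlinarith [sq_nonneg (K : ℝ)]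
  have hMB2 : 4 * B ^ 2 ≤ M := by rw [hM]; nlinarith [sq_nonneg (K : ℝ)]
  have hMK' : 2 * (K' : ℝ) ≤ M := by rw [hM]; nlinarith [sq_nonneg (K : ℝ), sq_nonneg B]
  refine ⟨M, by positivity, fun x => (hB x).trans (by linarith),
    fun x y => (hdiffle x y).trans (by linarith), fun x h => hmin _ _ ?_ ?_,
    fun x h => hmin _ _ ?_ ?_⟩
  · have := hK.dist_le_mul x (x + h)
    rw [Real.dist_eq, Real.dist_eq, show x - (x + h) = -h by ring, abs_neg] at this
    rw [← sq_abs, ← sq_abs h]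
    calc |φ x - φ (x + h)| ^ 2 ≤ (K * |h|) ^ 2 := pow_le_pow_left₀ (abs_nonneg _) this 2
      _ = K ^ 2 * |h| ^ 2 := by ring
      _ ≤ M * |h| ^ 2 := mul_le_mul_of_nonneg_right hMK (sq_nonneg _)
  · rw [← sq_abs]
    calc |φ x - φ (x + h)| ^ 2 ≤ (2 * B) ^ 2 := pow_le_pow_left₀ (abs_nonneg _) (hdiffle _ _) 2
      _ = 4 * B ^ 2 := by ring
      _ ≤ M := hMB2
  · exact (hsecond' x h).trans (mul_le_mul_of_nonneg_right hMK' (sq_nonneg _))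
  · have h1 := abs_add_le (φ x - φ (x + h)) (φ x - φ (x - h))
    rw [show φ x - φ (x + h) + (φ x - φ (x - h)) = 2 * φ x - φ (x + h) - φ (x - h) by ring] at h1
    linarith [hdiffle x (x + h), hdiffle x (x - h)]

end IsTestFunction

theorem diffQuot_mul {α : ℝ} (h0 : 0 < α) (φ ψ : ℝ → ℝ) (p : ℝ × ℝ) :
    diffQuot α φ p * diffQuot α ψ p =
      (φ p.1 - φ p.2) * (ψ p.1 - ψ p.2) / |p.1 - p.2| ^ (1 + α) := by
  have : |p.1 - p.2| ^ (1 + α) = |p.1 - p.2| ^ ((1 + α) / 2) * |p.1 - p.2| ^ ((1 + α) / 2) := by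
    rw [← Real.rpow_add_of_nonneg (abs_nonneg _) (by linarith) (by linarith)]
    congr 1; ring
  rw [diffQuot, diffQuot, this, div_mul_div_comm]

theorem shear_integrable_iff {g : ℝ × ℝ → ℝ} :
    Integrable (fun z : ℝ × ℝ => g (z.1, z.1 + z.2)) ↔ Integrable g :=
  (measurePreserving_prod_add (volume : Measure ℝ) volume).integrable_comp_emb
    (MeasurableEquiv.shearAddRight ℝ).measurableEmbedding

theorem shear_integral (g : ℝ × ℝ → ℝ) :
    ∫ z : ℝ × ℝ, g (z.1, z.1 + z.2) = ∫ z, g z :=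
  (measurePreserving_prod_add (volume : Measure ℝ) volume).integral_comp
    (MeasurableEquiv.shearAddRight ℝ).measurableEmbedding g

theorem measurable_diffQuot (α : ℝ) {φ : ℝ → ℝ} (hφ : Measurable φ) :
    Measurable (diffQuot α φ) := by
  unfold diffQuot; fun_prop

/-- In the coordinates `(x, x + h)` the difference vanishes unless one of the two points lies in
`Ω`. Two indicators times the integrable kernel therefore dominate the square. -/
theorem memLp_diffQuot {α : ℝ} (h0 : 0 < α) (h2 : α < 2) {φ : ℝ → ℝ} (hφ : IsTestFunction φ) :
    MemLp (diffQuot α φ) 2 := by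
  obtain ⟨M, hM0, -, -, hM, -⟩ := hφ.exists_bounds
  have hmeas := measurable_diffQuot α hφ.continuous.measurable
  rw [memLp_two_iff_integrable_sq hmeas.aestronglyMeasurable, ← shear_integrable_iff]
  have hI : Integrable (indicator Om fun _ => M) := by
    refine (integrable_indicator_iff measurableSet_Ioo).2 (integrableOn_const ?_)
    simp [Real.volume_Ioo]
  have h1 : Integrable fun z : ℝ × ℝ => indicator Om (fun _ => M) z.1 * kernel α z.2 :=
    hI.mul_prod (integrable_kernel h0 h2)
  have h3 : Integrable fun z : ℝ × ℝ => indicator Om (fun _ => M) (z.1 + z.2) * kernel α z.2 :=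
    ((measurePreserving_add_prod (volume : Measure ℝ) volume).integrable_comp
      h1.aestronglyMeasurable).2 h1
  refine (h1.add h3).mono' ?_ (Eventually.of_forall fun z => ?_)
  · have : Measurable fun z : ℝ × ℝ => (z.1, z.1 + z.2) := by fun_prop
    exact ((hmeas.comp this).pow_const 2).aestronglyMeasurable
  · obtain ⟨x, h⟩ := z
    have e : diffQuot α φ (x, x + h) ^ 2 = (φ x - φ (x + h)) ^ 2 / |h| ^ (1 + α) := by
      rw [sq, diffQuot_mul h0, ← sq]; simp
    simp only [Pi.add_apply]
    rw [e, Real.norm_of_nonneg (by positivity)]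
    have key : (φ x - φ (x + h)) ^ 2 / |h| ^ (1 + α) ≤ M * kernel α h := by
      rw [kernel, mul_div_assoc']
      exact div_le_div_of_nonneg_right (hM x h) (by positivity)
    have hk := mul_nonneg hM0 (kernel_nonneg α h)
    by_cases hx : x ∈ Om
    · rw [indicator_of_mem hx]
      by_cases hy : x + h ∈ Om
      · rw [indicator_of_mem hy]; linarith
      · rw [indicator_of_notMem hy]; linarith
    · rw [indicator_of_notMem hx]
      by_cases hy : x + h ∈ Om
      · rw [indicator_of_mem hy]; linarith
      · rw [indicator_of_notMem hy, hφ.eq_zero hx, hφ.eq_zero hy]; simp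

/-- The fractional Laplacian without its normalising constant, by symmetric second differences. -/
noncomputable def symmLap (α : ℝ) (φ : ℝ → ℝ) (x : ℝ) : ℝ :=
  ∫ h, (2 * φ x - φ (x + h) - φ (x - h)) / (2 * |h| ^ (1 + α))

section SymmLap

variable {α : ℝ} (h0 : 0 < α) (h2 : α < 2) {φ : ℝ → ℝ} (hφ : IsTestFunction φ)
include h0 h2 hφ

omit h0 h2 in
theorem exists_second_difference_bound : ∃ M : ℝ, 0 ≤ M ∧ ∀ x h,
    ‖(2 * φ x - φ (x + h) - φ (x - h)) / (2 * |h| ^ (1 + α))‖ ≤ M * kernel α h := by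
  obtain ⟨M, hM0, -, -, -, hM⟩ := hφ.exists_bounds
  refine ⟨M, hM0, fun x h => ?_⟩
  rw [norm_div, Real.norm_eq_abs, Real.norm_of_nonneg (by positivity), kernel, mul_div_assoc']
  have hp : 0 ≤ |h| ^ (1 + α) := by positivity
  refine (div_le_div_of_nonneg_right (hM x h) (by positivity)).trans ?_
  rw [mul_comm 2, ← div_div]
  exact half_le_self (by positivity)

theorem continuous_symmLap : Continuous (symmLap α φ) := by
  obtain ⟨M, hM0, hM⟩ := exists_second_difference_bound (α := α) hφ
  have hc := hφ.continuous
  refine continuous_of_dominated (bound := fun h => M * kernel α h) (fun x => ?_)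
    (fun x => Eventually.of_forall (hM x)) ((integrable_kernel h0 h2).const_mul M)
    (Eventually.of_forall fun h => by fun_prop)
  have hm := hc.measurable
  refine Measurable.aestronglyMeasurable ?_
  fun_prop

theorem exists_symmLap_bound : ∃ B : ℝ, ∀ x, ‖symmLap α φ x‖ ≤ B := by
  obtain ⟨M, hM0, hM⟩ := exists_second_difference_bound (α := α) hφ
  exact ⟨_, fun x => norm_integral_le_of_norm_le ((integrable_kernel h0 h2).const_mul M)
    (Eventually.of_forall (hM x))⟩

/-- Averaging `h` with `-h` in the truncated integral replaces first differences by second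
differences. These are of order `h ^ 2`, so the principal value becomes an absolutely convergent
integral by dominated convergence. -/
theorem fracLap_eq (x : ℝ) : fracLap α φ x = fracConst α * symmLap α φ x := by
  obtain ⟨M, hM0, hM⟩ := exists_second_difference_bound (α := α) hφ
  obtain ⟨M', hM0', -, hM', -, -⟩ := hφ.exists_bounds
  have hc := hφ.continuous
  have hm := hc.measurable
  rw [fracLap]
  congr 1
  refine Tendsto.limUnder_eq ?_
  have hset : ∀ ε : ℝ, MeasurableSet {h : ℝ | ε < |h|} := fun ε =>
    measurableSet_lt measurable_const measurable_abs
  have hlim : Tendsto (fun ε : ℝ => ∫ h, indicator {h : ℝ | ε < |h|}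
      (fun h => (2 * φ x - φ (x + h) - φ (x - h)) / (2 * |h| ^ (1 + α))) h) (𝓝[>] 0)
      (𝓝 (symmLap α φ x)) := by
    refine tendsto_integral_filter_of_dominated_convergence (fun h => M * kernel α h)
      (Eventually.of_forall fun ε => ?_)
      (Eventually.of_forall fun ε => Eventually.of_forall fun h => ?_)
      ((integrable_kernel h0 h2).const_mul M) ?_
    · refine (Measurable.indicator ?_ (hset ε)).aestronglyMeasurable
      fun_prop
    · exact (norm_indicator_le_norm_self _ _).trans (hM x h)
    · have hne : ∀ᵐ h : ℝ, h ≠ 0 := by simp [ae_iff]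
      filter_upwards [hne] with h hh
      refine tendsto_const_nhds.congr' ?_
      filter_upwards [nhdsWithin_le_nhds (gt_mem_nhds (abs_pos.2 hh))] with ε hε
      rw [indicator_of_mem (show h ∈ {h : ℝ | ε < |h|} from hε)]
  refine hlim.congr' ?_
  filter_upwards [self_mem_nhdsWithin] with ε (hε : 0 < ε)
  set F : ℝ → ℝ := fun h => indicator {h : ℝ | ε < |h|}
    (fun h => (φ x - φ (x + h)) / |h| ^ (1 + α)) h with hF
  -- On `|h| > ε` the kernel's numerator is at least `min (ε ^ 2) 1`, so bounded first differences
  -- suffice.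
  have hFi : Integrable F := by
    refine ((integrable_kernel h0 h2).const_mul (M' / min (ε ^ 2) 1)).mono' ?_
      (Eventually.of_forall fun h => ?_)
    · refine (Measurable.indicator ?_ (hset ε)).aestronglyMeasurable
      fun_prop
    · by_cases hh : ε < |h|
      · rw [hF]
        simp only
        rw [indicator_of_mem (show h ∈ {h : ℝ | ε < |h|} from hh), norm_div, Real.norm_eq_abs,
          Real.norm_of_nonneg (by positivity), kernel, mul_div_assoc']
        refine div_le_div_of_nonneg_right ?_ (by positivity)
        have hpos : 0 < min (ε ^ 2) 1 := by positivity
        rw [div_mul_eq_mul_div, le_div_iff₀ hpos]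
        refine mul_le_mul (hM' _ _) (min_le_min_right 1 ?_) hpos.le hM0'
        rw [← sq_abs h]
        exact pow_le_pow_left₀ hε.le hh.le 2
      · rw [hF]
        simp only
        rw [indicator_of_notMem (show h ∉ {h : ℝ | ε < |h|} from hh), norm_zero]
        exact mul_nonneg (by positivity) (kernel_nonneg _ _)
  have e1 : ∫ y in {y : ℝ | ε < |x - y|}, (φ x - φ y) / |x - y| ^ (1 + α) = ∫ h, F h := by
    have hs : MeasurableSet {y : ℝ | ε < |x - y|} :=
      measurableSet_lt measurable_const (by fun_prop)
    rw [← integral_indicator hs, ← integral_add_left_eq_self _ x]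
    refine integral_congr_ae (Eventually.of_forall fun h => ?_)
    simp [hF, indicator]
  have e2 : ∫ h, F (-h) = ∫ h, F h := integral_neg_eq_self F volume
  have e3 : ∫ h, indicator {h : ℝ | ε < |h|}
      (fun h => (2 * φ x - φ (x + h) - φ (x - h)) / (2 * |h| ^ (1 + α))) h =
      ∫ h, (1 / 2) * (F h + F (-h)) := by
    refine integral_congr_ae (Eventually.of_forall fun h => ?_)
    by_cases hh : ε < |h|
    · simp only [hF, indicator, mem_ofPred_eq, hh, abs_neg, if_true, ← sub_eq_add_neg]
      rw [← add_div, div_mul_div_comm, one_mul]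
      congr 1
      ring
    · simp [hF, indicator, hh]
  rw [e1, e3, integral_const_mul, integral_add hFi hFi.comp_neg, e2]
  ring

/-- Fubini reduces both sides to a fixed shift `h`; there translation invariance in `x` identifies
the two integrals. -/
theorem integral_mul_symmLap {ψ : ℝ → ℝ} (hψ : IsTestFunction ψ) :
    ∫ x, ψ x * symmLap α φ x = (1 / 2) * ∫ p, diffQuot α ψ p * diffQuot α φ p := by
  obtain ⟨M, hM0, hM⟩ := exists_second_difference_bound (α := α) hφ
  have hc := hφ.continuous
  have hm := hc.measurable
  have hcψ := hψ.continuous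
  have hmψ := hcψ.measurable
  have hint : Integrable (Function.uncurry fun x h : ℝ =>
      ψ x * ((2 * φ x - φ (x + h) - φ (x - h)) / (2 * |h| ^ (1 + α))))
      ((volume : Measure ℝ).prod volume) := by
    refine ((hψ.integrable.norm.mul_prod ((integrable_kernel h0 h2).const_mul M))).mono' ?_
      (Eventually.of_forall fun z => ?_)
    · refine Measurable.aestronglyMeasurable ?_
      simp only [Function.uncurry_def]
      fun_prop
    · simp only [Function.uncurry_def]
      rw [norm_mul]
      exact mul_le_mul_of_nonneg_left (hM _ _) (norm_nonneg _)
  have hE : Integrable (fun p => diffQuot α ψ p * diffQuot α φ p) :=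
    (memLp_diffQuot h0 h2 hψ).integrable_mul (memLp_diffQuot h0 h2 hφ)
  have hE' := shear_integrable_iff.2 hE
  rw [← shear_integral, Measure.volume_eq_prod, integral_prod_symm _ hE']
  simp only [symmLap]
  simp_rw [← integral_const_mul]
  rw [integral_integral_swap hint]
  refine integral_congr_ae (Eventually.of_forall fun h => ?_)
  simp only [diffQuot_mul h0, sub_add_cancel_left, abs_neg]
  have hpp : ∀ a b : ℝ, Integrable fun x => ψ (x + a) * φ (x + b) := fun a b =>
    Continuous.integrable_of_hasCompactSupport (by fun_prop)
      ((hψ.2.1.comp_homeomorph (Homeomorph.addRight a)).mul_right)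
  have hpp0 : Integrable fun x => ψ x * φ x := by simpa using hpp 0 0
  have hpp1 : Integrable fun x => ψ x * φ (x + h) := by simpa using hpp 0 h
  have hpp2 : Integrable fun x => ψ x * φ (x - h) := by simpa [sub_eq_add_neg] using hpp 0 (-h)
  have hpp3 : Integrable fun x => ψ (x + h) * φ x := by simpa using hpp h 0
  have hpp4 : Integrable fun x => ψ (x + h) * φ (x + h) := hpp h h
  have t1 : ∫ x, ψ (x + h) * φ (x + h) = ∫ x, ψ x * φ x :=
    integral_add_right_eq_self (fun x => ψ x * φ x) h
  have t2 : ∫ x, ψ (x + h) * φ x = ∫ x, ψ x * φ (x - h) := by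
    rw [← integral_add_right_eq_self (fun x => ψ x * φ (x - h)) h]
    simp
  have l1 : ∫ x, ψ x * ((2 * φ x - φ (x + h) - φ (x - h)) / (2 * |h| ^ (1 + α))) =
      (2 * (∫ x, ψ x * φ x) - (∫ x, ψ x * φ (x + h)) - ∫ x, ψ x * φ (x - h)) /
        (2 * |h| ^ (1 + α)) := by
    have i1 : Integrable fun x => 2 * (ψ x * φ x) - ψ x * φ (x + h) := (hpp0.const_mul 2).sub hpp1
    rw [← integral_const_mul, ← integral_sub (hpp0.const_mul 2) hpp1, ← integral_sub i1 hpp2, ← integral_div]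
    refine integral_congr_ae (Eventually.of_forall fun x => ?_)
    ring
  have l2 : ∫ x, (ψ x - ψ (x + h)) * (φ x - φ (x + h)) / |h| ^ (1 + α) =
      ((∫ x, ψ x * φ x) - (∫ x, ψ x * φ (x + h)) - (∫ x, ψ (x + h) * φ x) +
        ∫ x, ψ (x + h) * φ (x + h)) / |h| ^ (1 + α) := by
    have i1 : Integrable fun x => ψ x * φ x - ψ x * φ (x + h) := hpp0.sub hpp1
    have i2 : Integrable fun x => ψ x * φ x - ψ x * φ (x + h) - ψ (x + h) * φ x := i1.sub hpp3
    rw [← integral_sub hpp0 hpp1, ← integral_sub i1 hpp3, ← integral_add i2 hpp4, ← integral_div]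
    refine integral_congr_ae (Eventually.of_forall fun x => ?_)
    ring
  rw [integral_const_mul, l1, l2, t1, t2, div_mul_div_comm, one_mul]
  congr 1
  ring

end SymmLap

end FracDiffusion

/-! ### The Gagliardo form and the operator it defines. -/

namespace FracDiffusion

open scoped RealInnerProductSpace
open ContinuousLinearMap (adjoint adjoint_inner_left adjoint_inner_right)

theorem fracConst_pos {α : ℝ} (h0 : 0 < α) (h2 : α < 2) : 0 < fracConst α := by
  have h3 := Real.Gamma_pos_of_pos (show 0 < (1 + α) / 2 by linarith)
  have h4 := Real.Gamma_pos_of_pos (show 0 < 1 - α / 2 by linarith)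
  have := Real.pi_pos
  unfold fracConst
  positivity

/-- The inclusion of `H_0^{α/2}(Ω)` in `L²(Ω)` as a bounded operator. -/
noncomputable def inclusion (α : ℝ) : H0 α →L[ℝ] L2Om :=
  (WithLp.fstL 2 ℝ L2Om L2Plane).comp (testPairs α).topologicalClosure.subtypeL

theorem inclusion_apply {α : ℝ} (U : H0 α) : inclusion α U = toL2 U := rfl

theorem inner_H0 {α : ℝ} (U W : H0 α) :
    ⟪U, W⟫ = ⟪inclusion α U, inclusion α W⟫ + ⟪U.1.snd, W.1.snd⟫ := by
  rw [Submodule.coe_inner, WithLp.prod_inner_apply]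
  rfl

theorem norm_inclusion_le {α : ℝ} (U : H0 α) : ‖inclusion α U‖ ≤ ‖U‖ := by
  have h1 := inner_H0 U U
  rw [real_inner_self_eq_norm_sq, real_inner_self_eq_norm_sq, real_inner_self_eq_norm_sq] at h1
  refine le_of_sq_le_sq ?_ (norm_nonneg _)
  nlinarith [sq_nonneg ‖U.1.snd‖]

/-- Vectors orthogonal to all test functions vanish. -/
theorem eq_zero_of_orthogonal_testPairs {α : ℝ} (U : H0 α)
    (h : ∀ Φ : H0 α, Φ.1 ∈ testPairs α → ⟪U, Φ⟫ = 0) : U = 0 := by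
  have h1 : (U : WithLp 2 (L2Om × L2Plane)) ∈ (testPairs α)ᗮ := by
    rw [Submodule.mem_orthogonal']
    intro Φ hΦ
    exact h ⟨Φ, (testPairs α).le_topologicalClosure hΦ⟩ hΦ
  rw [← Submodule.orthogonal_closure] at h1
  have h3 : ⟪U.1, U.1⟫ = 0 := Submodule.inner_right_of_mem_orthogonal U.2 h1
  exact Subtype.ext (inner_self_eq_zero.1 h3)

theorem exists_testPair {α : ℝ} (h0 : 0 < α) (h2 : α < 2) {φ : ℝ → ℝ} (hφ : IsTestFunction φ) :
    ∃ Φ : H0 α, Φ.1 ∈ testPairs α ∧ (inclusion α Φ : ℝ → ℝ) =ᵐ[volume.restrict Om] φ ∧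
      (Φ.1.snd : ℝ × ℝ → ℝ) =ᵐ[volume] diffQuot α φ := by
  have h1 : MemLp φ 2 (volume.restrict Om) := by
    obtain ⟨M, -, hM, -⟩ := hφ.exists_bounds
    exact MemLp.of_bound hφ.continuous.aestronglyMeasurable M (Eventually.of_forall hM)
  have h3 := memLp_diffQuot h0 h2 hφ
  let Φ : WithLp 2 (L2Om × L2Plane) := WithLp.toLp 2 (h1.toLp φ, h3.toLp _)
  have hΦ : Φ ∈ testPairs α := ⟨φ, hφ, h1.coeFn_toLp, h3.coeFn_toLp⟩
  exact ⟨⟨Φ, (testPairs α).le_topologicalClosure hΦ⟩, hΦ, h1.coeFn_toLp, h3.coeFn_toLp⟩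

theorem inner_eq_integral {X : Type*} [MeasurableSpace X] {μ : Measure X} (u v : Lp ℝ 2 μ)
    {a b : X → ℝ} (hu : u =ᵐ[μ] a) (hv : v =ᵐ[μ] b) : ⟪u, v⟫ = ∫ x, a x * b x ∂μ := by
  rw [L2.inner_def]
  refine integral_congr_ae ?_
  filter_upwards [hu, hv] with x hx hy
  rw [hx, hy]
  exact mul_comm _ _

section Form

variable {α : ℝ} (h0 : 0 < α) (h2 : α < 2)
include h0 h2

theorem memLp_fracLap {φ : ℝ → ℝ} (hφ : IsTestFunction φ) :
    MemLp (fracLap α φ) 2 (volume.restrict Om) := by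
  have e : fracLap α φ = fun x => fracConst α * symmLap α φ x :=
    funext (fracLap_eq h0 h2 hφ)
  rw [e]
  obtain ⟨B, hB⟩ := exists_symmLap_bound h0 h2 hφ
  exact (MemLp.of_bound (continuous_symmLap h0 h2 hφ).aestronglyMeasurable B
    (Eventually.of_forall hB)).const_mul _

/-- The fractional Laplacian of a test function represents the Gagliardo form. -/
theorem integral_mul_fracLap {φ : ℝ → ℝ} (hφ : IsTestFunction φ) (Φ : H0 α)
    (hΦ : (Φ.1.snd : ℝ × ℝ → ℝ) =ᵐ[volume] diffQuot α φ) (U : H0 α) :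
    ∫ x in Om, inclusion α U x * fracLap α φ x = fracConst α / 2 * ⟪U.1.snd, Φ.1.snd⟫ := by
  have hL := memLp_fracLap h0 h2 hφ
  set l : L2Om := hL.toLp _
  have hl : (l : ℝ → ℝ) =ᵐ[volume.restrict Om] fracLap α φ := hL.coeFn_toLp
  have hint : ∀ u : L2Om, ∫ x in Om, u x * fracLap α φ x = ⟪u, l⟫ := fun u =>
    (inner_eq_integral u l EventuallyEq.rfl hl).symm
  rw [hint]
  -- Both sides pair a component of the element with a fixed `L²` function, hence are continuous,
  -- and it is enough to check test functions.
  have hclosed : IsClosed {V : WithLp 2 (L2Om × L2Plane) |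
      ⟪V.fst, l⟫ = fracConst α / 2 * ⟪V.snd, Φ.1.snd⟫} := by
    have c1 : Continuous fun V : WithLp 2 (L2Om × L2Plane) => V.fst :=
      (WithLp.fstL 2 ℝ L2Om L2Plane).continuous
    have c2 : Continuous fun V : WithLp 2 (L2Om × L2Plane) => V.snd :=
      (WithLp.sndL 2 ℝ L2Om L2Plane).continuous
    exact isClosed_eq (c1.inner continuous_const)
      (continuous_const.mul (c2.inner continuous_const))
  refine closure_minimal ?_ hclosed U.2
  rintro V ⟨ψ, hψ, hV1, hV2⟩
  show ⟪V.fst, l⟫ = fracConst α / 2 * ⟪V.snd, Φ.1.snd⟫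
  rw [inner_eq_integral _ _ hV1 hl, inner_eq_integral _ _ hV2 hΦ]
  have e1 : ∫ x in Om, ψ x * fracLap α φ x = ∫ x, ψ x * fracLap α φ x := by
    refine setIntegral_eq_integral_of_forall_compl_eq_zero fun x hx => ?_
    rw [hψ.eq_zero hx, zero_mul]
  rw [e1]
  simp_rw [fracLap_eq h0 h2 hφ, mul_left_comm _ (fracConst α)]
  rw [integral_const_mul, integral_mul_symmLap h0 h2 hφ hψ]
  ring

/-- This is closability of the form. If the `L²` component vanishes, `integral_mul_fracLap` makes
the second component orthogonal to every test difference quotient, so the pair is orthogonal to a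
dense subspace. -/
theorem inclusion_injective : Function.Injective (inclusion α) := by
  rw [injective_iff_map_eq_zero]
  intro U hU
  refine eq_zero_of_orthogonal_testPairs U ?_
  rintro Φ ⟨φ, hφ, -, hΦ⟩
  have h1 := integral_mul_fracLap h0 h2 hφ Φ hΦ U
  have h3 : ∫ x in Om, inclusion α U x * fracLap α φ x = 0 := by
    rw [hU]
    refine integral_eq_zero_of_ae ?_
    filter_upwards [Lp.coeFn_zero ℝ 2 (volume.restrict Om)] with x hx
    rw [hx]; simp
  rw [h3] at h1
  have hc := fracConst_pos h0 h2
  rw [inner_H0, hU, inner_zero_left, zero_add]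
  exact (mul_eq_zero.1 h1.symm).resolve_left (by positivity)

/-- A function orthogonal to the range integrates to zero against all test functions, so it vanishes
almost everywhere on `Ω`. -/
theorem inclusion_denseRange : DenseRange (inclusion α) := by
  have h1 : (LinearMap.range (inclusion α).toLinearMap).topologicalClosure = ⊤ := by
    rw [Submodule.topologicalClosure_eq_top_iff, Submodule.eq_bot_iff]
    intro u hu
    have hint : LocallyIntegrableOn u Om volume :=
      IntegrableOn.locallyIntegrableOn ((Lp.memLp u).integrable one_le_two)
    have hz := isOpen_Ioo.ae_eq_zero_of_integral_contDiff_smul_eq_zero hint (by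
      intro φ h1 h3 h4
      have hφ : IsTestFunction φ := ⟨h1, h3, h4⟩
      obtain ⟨Φ, -, hΦ, -⟩ := exists_testPair h0 h2 hφ
      have h5 : ⟪inclusion α Φ, u⟫ = 0 :=
        Submodule.inner_right_of_mem_orthogonal
          (LinearMap.mem_range_self (inclusion α).toLinearMap Φ) hu
      rw [inner_eq_integral _ _ hΦ EventuallyEq.rfl] at h5
      rw [← h5]
      symm
      refine setIntegral_eq_integral_of_forall_compl_eq_zero fun x hx => ?_
      rw [hφ.eq_zero hx, zero_mul])
    refine Lp.ext ?_
    refine EventuallyEq.trans ?_ (Lp.coeFn_zero ℝ 2 (volume.restrict Om)).symm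
    exact (ae_restrict_iff' measurableSet_Ioo).2 hz
  exact Submodule.dense_iff_topologicalClosure_eq_top.2 h1

/-- The operator defined by the distributional fractional Laplacian is the form operator. -/
theorem isFracLap_neg_iff (u w : L2Om) :
    IsFracLap α u (-w) ↔
      u = inclusion α (adjoint (inclusion α) (u - (fracConst α / 2)⁻¹ • w)) := by
  have hc : 0 < fracConst α / 2 := half_pos (fracConst_pos h0 h2)
  have hw : ∀ (Φ : H0 α) (φ : ℝ → ℝ), (inclusion α Φ : ℝ → ℝ) =ᵐ[volume.restrict Om] φ →
      ∫ x in Om, (-w : L2Om) x * φ x = -⟪w, inclusion α Φ⟫ := fun Φ φ h => by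
    rw [← inner_neg_left, inner_eq_integral _ _ EventuallyEq.rfl h]
  constructor
  · rintro ⟨⟨U, hU⟩, h⟩
    rw [← inclusion_apply] at hU
    -- Testing against `Φ` suffices. The distributional equation fixes the inner product of
    -- difference quotients as `-c⁻¹ ⟪w, φ⟫`, and adding `⟪u, φ⟫` completes the inner product of the
    -- form space.
    have key : U = adjoint (inclusion α) (u - (fracConst α / 2)⁻¹ • w) := by
      refine sub_eq_zero.1 (eq_zero_of_orthogonal_testPairs _ ?_)
      rintro Φ ⟨φ, hφ, hΦ1, hΦ2⟩
      have h1 := h φ hφ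
      rw [hw Φ φ hΦ1, ← hU, integral_mul_fracLap h0 h2 hφ Φ hΦ2] at h1
      rw [inner_sub_left, adjoint_inner_left, inner_H0, hU, inner_sub_left, real_inner_smul_left]
      have h3 : ⟪U.1.snd, Φ.1.snd⟫ = -((fracConst α / 2)⁻¹ * ⟪w, inclusion α Φ⟫) := by
        rw [← mul_neg, ← h1, inv_mul_cancel_left₀ hc.ne']
      linarith
    rw [← key, hU]
  · intro h
    set U := adjoint (inclusion α) (u - (fracConst α / 2)⁻¹ • w) with hU
    refine ⟨⟨U, h.symm⟩, fun φ hφ => ?_⟩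
    obtain ⟨Φ, -, hΦ1, hΦ2⟩ := exists_testPair h0 h2 hφ
    rw [hw Φ φ hΦ1]
    have h1 : ⟪U, Φ⟫ = _ := adjoint_inner_left (inclusion α) Φ _
    rw [inner_H0, ← h, inner_sub_left, real_inner_smul_left] at h1
    have h3 : ∫ x in Om, u x * fracLap α φ x = fracConst α / 2 * ⟪U.1.snd, Φ.1.snd⟫ := by
      rw [← integral_mul_fracLap h0 h2 hφ Φ hΦ2 U, ← h]
    rw [h3, show ⟪U.1.snd, Φ.1.snd⟫ = -((fracConst α / 2)⁻¹ * ⟪w, inclusion α Φ⟫) by linarith,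
      mul_neg, mul_inv_cancel_left₀ hc.ne']

end Form

theorem isFracSemigroup_iff {α : ℝ} {S : ℝ → L2Om →L[ℝ] L2Om} :
    IsFracSemigroup α S ↔ ContractionSemigroup.IsC0Semigroup S ∧
      ∀ u w, ContractionSemigroup.HasGenerator S u w ↔ IsFracLap α u (-w) :=
  ⟨fun h => ⟨⟨h.zero, h.add, h.cont⟩, h.generator⟩,
    fun h => ⟨h.1.zero, h.1.add, h.1.cont, h.2⟩⟩

end FracDiffusion

theorem theorem4p2 (α : ℝ) (hα : α ∈ Set.Ioo (0 : ℝ) 2)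
    (f : FracDiffusion.H0 α → FracDiffusion.H0 α) (hf : LocallyLipschitz f)
    (g : FracDiffusion.L2Om) (u₀ : FracDiffusion.H0 α) :
    ∃ T₀ : ℝ, 0 < T₀ ∧ ∀ T : ℝ, 0 < T → T ≤ T₀ →
      ∃ u : ℝ → FracDiffusion.H0 α,
        FracDiffusion.IsMildSolution α f g u₀ T u ∧
        ∀ v : ℝ → FracDiffusion.H0 α,
          FracDiffusion.IsMildSolution α f g u₀ T v → Set.EqOn v u (Set.Icc 0 T) := by
  have : CompleteSpace (FracDiffusion.H0 α) :=
    (FracDiffusion.testPairs α).isClosed_topologicalClosure.completeSpace_coe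
  -- The speed is half of `fracConst α`, the factor `1/2` being that of `integral_mul_symmLap`.
  refine ContractionSemigroup.exists_unique_mild_solution FracDiffusion.norm_inclusion_le
    (FracDiffusion.inclusion_injective hα.1 hα.2) (FracDiffusion.inclusion_denseRange hα.1 hα.2)
    (half_pos (FracDiffusion.fracConst_pos hα.1 hα.2))
    (FracDiffusion.isFracLap_neg_iff hα.1 hα.2) hf g u₀ fun T u => ?_
  simp only [FracDiffusion.IsMildSolution, FracDiffusion.isFracSemigroup_iff, and_assoc,
    FracDiffusion.inclusion_apply]
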